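/- Let $n\ge 1$, $\mathbb R^n_+=(0,\infty)^n$ with Lebesgue measure, $\nu=(\nu_1,\dots,\nu_n)\in[-1/2,\infty)^n$, and write $|\alpha|=\alpha_1+\dots+\alpha_n$ for $\alpha\in\mathbb N^n$ (where $\mathbb N=\{0,1,2,\dots\}$) and $|\nu|=\nu_1+\dots+\nu_n$. For $\alpha\in\mathbb N^n$ let $$\varphi_\alpha^\nu(x)=\prod_{j=1}^n\Big(\frac{2\Gamma(\alpha_j+1)}{\Gamma(\alpha_j+\nu_j+1)}\Big)^{1/2}L_{\nu_j}^{\alpha_j}(x_j^2)\,x_j^{\nu_j+1/2}e^{-x_j^2/2},\qquad x\in\mathbb R^n_+,$$ be the Laguerre functions, where $L_{a}^{m}$ is the Laguerre polynomial of degree $m$ and order $a$. They form an orthonormal basis of $L^2(\mathbb R^n_+)$ and are eigenfunctions, with eigenvalues $4|\alpha|+2|\nu|+2n$, of $$\sum_{j=1}^n\Big[-\frac{\partial^2}{\partial x_j^2}+x_j^2+\frac1{x_j^2}\Big(\nu_j^2-\frac14\Big)\Big];$$ let $\mathcal L_\nu$ be the self-adjoint extension of this operator defined by the corresponding spectral decomposition,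 so that for $s\ge 0$ and $f\in L^2(\mathbb R^n_+)$ $$\mathcal L_\nu^{-s}f=\sum_{\alpha\in\mathbb N^n}(4|\alpha|+2|\nu|+2n)^{-s}\langle f,\varphi_\alpha^\nu\rangle\varphi_\alpha^\nu\quad\text{in }L^2(\mathbb R^n_+).$$ For $j=1,\dots,n$ put $\delta_{\nu_j}=\frac{\partial}{\partial x_j}+x_j-\frac1{x_j}\big(\nu_j+\frac12\big)$, and for $k\in\mathbb N^n$ put $\delta_\nu^k=\delta_{\nu_n}^{k_n}\cdots\delta_{\nu_1}^{k_1}$, acting in the sense of distributions on $\mathbb R^n_+$. Then, for every multi-index $k\in\mathbb N^n$, the higher-order Riesz transform $\delta_\nu^k\mathcal L_\nu^{-|k|/2}$ is bounded on $L^2(\mathbb R^n_+)$: for every $f\in L^2(\mathbb R^n_+)$ the distribution $\delta_\nu^k\mathcal L_\nu^{-|k|/2}f$ is (given by) a function in $L^2(\mathbb R^n_+)$, and there is a constant $C$, depending only on $n,\nu,k$, such that $$\|\delta_\nu^k\mathcal L_\nu^{-|k|/2}f\|_{L^2(\mathbb R^n_+)}\le C\|f\|_{L^2(\mathbb R^n_+)}\qquad\text{for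 all }f\in L^2(\mathbb R^n_+).$$ -/

import Mathlib

open MeasureTheory

noncomputable section

namespace Laguerre

/-- The open orthant `ℝ^n_+ = (0, ∞)^n`. -/
def orthant (n : ℕ) : Set (Fin n → ℝ) := Set.univ.pi fun _ => Set.Ioi 0

/-- The complex Hilbert space `L²(ℝ^n_+, dx)`, for Lebesgue measure. -/
abbrev L2 (n : ℕ) : Type := Lp ℂ 2 ((volume : Measure (Fin n → ℝ)).restrict (orthant n))

/-- The Laguerre polynomial of degree `k` and order `a`,
`∑_{i ≤ k} Γ(k + a + 1) / Γ(i + a + 1) * (-x)^i / (i! (k - i)!)`. -/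
def laguerrePoly (a : ℝ) (k : ℕ) (x : ℝ) : ℝ :=
  ∑ i ∈ Finset.range (k + 1),
    Real.Gamma (k + a + 1) / Real.Gamma (i + a + 1) / (i.factorial * (k - i).factorial) * (-x) ^ i

/-- The one-dimensional Laguerre function of order `a` and index `k`, on `(0, ∞)`. -/
def laguerreFun1 (a : ℝ) (k : ℕ) (x : ℝ) : ℝ :=
  Real.sqrt (2 * Real.Gamma (k + 1) / Real.Gamma (k + a + 1)) * laguerrePoly a k (x ^ 2)
    * x ^ (a + 1 / 2) * Real.exp (-x ^ 2 / 2)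

/-- The Laguerre function `φ_α^ν` on `ℝ^n_+`. -/
def laguerreFun {n : ℕ} (ν : Fin n → ℝ) (α : Fin n → ℕ) (x : Fin n → ℝ) : ℝ :=
  ∏ j, laguerreFun1 (ν j) (α j) (x j)

theorem measurable_laguerreFun1 (a : ℝ) (k : ℕ) : Measurable (laguerreFun1 a k) := by
  unfold laguerreFun1 laguerrePoly
  fun_prop

theorem memLp_laguerreFun1 {a : ℝ} (ha : -1 / 2 ≤ a) (k : ℕ) :
    MemLp (laguerreFun1 a k) 2 (volume.restrict (Set.Ioi 0)) := by
  have key : ∀ i : ℕ, MemLp (fun x : ℝ => x ^ (2 * i) * x ^ (a + 1 / 2) * Real.exp (-x ^ 2 / 2)) 2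
      (volume.restrict (Set.Ioi 0)) := by
    intro i
    rw [memLp_two_iff_integrable_sq (by fun_prop)]
    have h := integrableOn_rpow_mul_exp_neg_mul_sq (b := 1) one_pos
      (s := 4 * i + (2 * a + 1)) (by have : (0 : ℝ) ≤ i := i.cast_nonneg; linarith)
    refine IntegrableOn.congr_fun h ?_ measurableSet_Ioi
    intro x hx
    have hx : 0 < x := hx
    have e1 : (x ^ (a + 1 / 2)) ^ 2 = x ^ (2 * a + 1) := by
      rw [← Real.rpow_natCast, ← Real.rpow_mul hx.le]
      congr 1
      push_cast
      ring
    have e2 : x ^ ((4 * i : ℝ)) = x ^ (4 * i) := by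
      rw [← Real.rpow_natCast]
      push_cast
      rfl
    have e3 : Real.exp (-x ^ 2 / 2) ^ 2 = Real.exp (-1 * x ^ 2) := by
      rw [← Real.exp_nat_mul]
      congr 1
      push_cast
      ring
    simp only [mul_pow, e1, e3, Real.rpow_add hx (4 * i : ℝ), e2]
    ring
  have hsum : laguerreFun1 a k = fun x => ∑ i ∈ Finset.range (k + 1),
      (Real.sqrt (2 * Real.Gamma (k + 1) / Real.Gamma (k + a + 1)) *
        (Real.Gamma (k + a + 1) / Real.Gamma (i + a + 1) / (i.factorial * (k - i).factorial)
          * (-1) ^ i)) * (x ^ (2 * i) * x ^ (a + 1 / 2) * Real.exp (-x ^ 2 / 2)) := by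
    funext x
    simp only [laguerreFun1, laguerrePoly, Finset.mul_sum, Finset.sum_mul]
    refine Finset.sum_congr rfl fun i _ => ?_
    rw [neg_pow (x ^ 2) i, ← pow_mul]
    ring
  rw [hsum]
  exact memLp_finsetSum _ fun i _ => (key i).const_mul _

theorem memLp_laguerreFun {n : ℕ} {ν : Fin n → ℝ} (hν : ∀ j, -1 / 2 ≤ ν j) (α : Fin n → ℕ) :
    MemLp (fun x => (laguerreFun ν α x : ℂ)) 2
      ((volume : Measure (Fin n → ℝ)).restrict (orthant n)) := by
  have hm : Measurable (laguerreFun ν α) := by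
    unfold laguerreFun
    exact Finset.measurable_prod _ fun j _ =>
      (measurable_laguerreFun1 (ν j) (α j)).comp (measurable_pi_apply j)
  suffices h : MemLp (laguerreFun ν α) 2
      ((volume : Measure (Fin n → ℝ)).restrict (orthant n)) from h.ofReal
  rw [memLp_two_iff_integrable_sq hm.aestronglyMeasurable, orthant, volume_pi,
    Measure.restrict_pi_pi]
  simp only [laguerreFun, ← Finset.prod_pow]
  exact Integrable.fintype_prod (f := fun j x => laguerreFun1 (ν j) (α j) x ^ 2)
    fun j => (memLp_laguerreFun1 (hν j) (α j)).integrable_sq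

/-- The Laguerre function `φ_α^ν` as an element of `L²(ℝ^n_+)`. -/
def laguerreL2 {n : ℕ} {ν : Fin n → ℝ} (hν : ∀ j, -1 / 2 ≤ ν j) (α : Fin n → ℕ) : L2 n :=
  (memLp_laguerreFun hν α).toLp _

/-- The eigenvalue `4|α| + 2|ν| + 2n` of the Laguerre operator at `φ_α^ν`. -/
def eigenvalue {n : ℕ} (ν : Fin n → ℝ) (α : Fin n → ℕ) : ℝ :=
  4 * ∑ j, (α j : ℝ) + 2 * ∑ j, ν j + 2 * n

/-- `g = 𝓛_ν^s f`, where `𝓛_ν` is the self-adjoint Laguerre operator, given by its spectral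
decomposition: the series `∑_α (4|α| + 2|ν| + 2n)^s ⟨f, φ_α^ν⟩ φ_α^ν` converges to `g` in
`L²(ℝ^n_+)`. For `s = 1` this is the graph of `𝓛_ν` itself. -/
def IsPower {n : ℕ} {ν : Fin n → ℝ} (hν : ∀ j, -1 / 2 ≤ ν j) (s : ℝ) (f g : L2 n) : Prop :=
  HasSum (fun α : Fin n → ℕ =>
    ((eigenvalue ν α ^ s : ℝ) : ℂ) • (inner ℂ (laguerreL2 hν α) f) • laguerreL2 hν α) g

/-- The formal adjoint `δ_{ν_j}^* = -∂/∂x_j + x_j - (ν_j + 1/2) / x_j` of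
`δ_{ν_j} = ∂/∂x_j + x_j - (ν_j + 1/2) / x_j`, acting on functions. -/
def deltaStar {n : ℕ} (ν : Fin n → ℝ) (j : Fin n) (ψ : (Fin n → ℝ) → ℝ) : (Fin n → ℝ) → ℝ :=
  fun x => -(fderiv ℝ ψ x (Pi.single j 1)) + (x j - 1 / x j * (ν j + 1 / 2)) * ψ x

/-- The formal adjoint `(δ_{ν_1}^*)^{k_1} ⋯ (δ_{ν_n}^*)^{k_n}` of
`δ_ν^k = δ_{ν_n}^{k_n} ⋯ δ_{ν_1}^{k_1}`, acting on functions. -/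
def deltaStarPow {n : ℕ} (ν : Fin n → ℝ) (k : Fin n → ℕ) (ψ : (Fin n → ℝ) → ℝ) :
    (Fin n → ℝ) → ℝ :=
  (List.finRange n).foldr (fun j F => (deltaStar ν j)^[k j] F) ψ

/-- `δ_ν^k g = h` in the sense of distributions on the open orthant: the two sides have the same
pairing with every test function `ψ ∈ C_c^∞(ℝ^n_+)`. All integrands are integrable, because
`deltaStarPow ν k ψ` is continuous with compact support inside the orthant. -/
def IsWeakDelta {n : ℕ} (ν : Fin n → ℝ) (k : Fin n → ℕ) (g h : L2 n) : Prop :=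
  ∀ ψ : (Fin n → ℝ) → ℝ, ContDiff ℝ (⊤ : ℕ∞) ψ → HasCompactSupport ψ → tsupport ψ ⊆ orthant n →
    ∫ x in orthant n, g x * (deltaStarPow ν k ψ x : ℂ) = ∫ x in orthant n, h x * (ψ x : ℂ)

/-- `h = δ_ν^k 𝓛_ν^{-|k|/2} f`: the negative power `𝓛_ν^{-|k|/2} f` exists in `L²(ℝ^n_+)`, and
`h` is the result of applying the differential operator `δ_ν^k` to it. -/
def IsRieszTransform {n : ℕ} {ν : Fin n → ℝ} (hν : ∀ j, -1 / 2 ≤ ν j) (k : Fin n → ℕ)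
    (f h : L2 n) : Prop :=
  ∃ g : L2 n, IsPower hν (-((∑ j, (k j : ℝ)) / 2)) f g ∧ IsWeakDelta ν k g h

end Laguerre

end

/-!
In one variable write `δ = d/dx + x - (a + 1/2) / x`. This operator kills `x^{a+1/2} e^{-x²/2}`, so
on `P(x) x^{a+1/2} e^{-x²/2}` it differentiates the polynomial `P`. The Laguerre functions of order
`a` correspond to `P = L_m^a(x²)` and those of order `a + 1` to `P = x L_m^{a+1}(x²)`, and `δ`
alternates between the two families: it maps `φ_m^a` to `-2 √m φ_{m-1}^{a+1}`
(`isDelta_laguerreFun1_even`) and `φ_m^{a+1}` to an explicit combination of the `φ_i^a`, `i ≤ m`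
(`isDelta_laguerreFun1_odd`). Hence the coordinates of `δ^p φ_m^a` in one of these two orthonormal
families form a triangular matrix, `deltaMatrix`.

After multiplication by the inverse square root of the eigenvalue, the first step is a bounded
shift, and the second is a bounded diagonal matrix plus a multiple of a discrete Hardy kernel
`b_i b_m / ∑_{i ≤ m} b_i²`. Both pass the Schur test with the weight `(i + a + 1)^{-1/2}`
(`schurBound_hardy`, `schurBound_stepMatrix`). The matrices are triangular and the eigenvalues
increase, so the Schur test passes to the matrix of `δ^p 𝓛^{-p/2}` (`schurBound_deltaMatrix`). It is
also multiplicative under tensor products (`SchurBound.pi`), and the eigenvalue in `n` variables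
dominates the eigenvalue of each variable; so the vectors `δ^k 𝓛^{-|k|/2} φ_α` have a bounded
synthesis operator (`exists_norm_sum_rieszImage_le`), which composed with the coefficient map
`f ↦ ⟨φ_α, f⟩` is the Riesz transform.

That this operator is `δ^k 𝓛^{-|k|/2}` in the sense of distributions is integration by parts for
each `φ_α` (`integral_prod_mul_deltaStarPow`), followed by summation, as pairing with a test function
is continuous on `L²`. Only the orthonormality of the Laguerre functions enters, not their
completeness.
-/

noncomputable section

namespace Laguerre

/-! ### The Schur test -/

/-- `K` passes the Schur test with weight `w` and constant `C`: the rows and the columns of `K`,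
paired with `w`, are at most `C` times `w`. For kernels `K ≥ 0`, bounding all finite partial sums
amounts to bounding the full sums and avoids any question of summability. -/
structure SchurBound {ι : Type*} (w : ι → ℝ) (K : ι → ι → ℝ) (C : ℝ) : Prop where
  row : ∀ i (s : Finset ι), ∑ m ∈ s, K i m * w m ≤ C * w i
  col : ∀ m (s : Finset ι), ∑ i ∈ s, K i m * w i ≤ C * w m

namespace SchurBound

variable {ι : Type*} {w : ι → ℝ} {K K' : ι → ι → ℝ} {C C' : ℝ}

theorem mono (h : SchurBound w K C) (hw : ∀ i, 0 ≤ w i) (hK : ∀ i m, K' i m ≤ K i m) :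
    SchurBound w K' C where
  row i s := (Finset.sum_le_sum fun m _ =>
    mul_le_mul_of_nonneg_right (hK i m) (hw m)).trans (h.row i s)
  col m s := (Finset.sum_le_sum fun i _ =>
    mul_le_mul_of_nonneg_right (hK i m) (hw i)).trans (h.col m s)

theorem add (h : SchurBound w K C) (h' : SchurBound w K' C') :
    SchurBound w (fun i m => K i m + K' i m) (C + C') where
  row i s := by
    simpa only [add_mul, Finset.sum_add_distrib] using add_le_add (h.row i s) (h'.row i s)
  col m s := by
    simpa only [add_mul, Finset.sum_add_distrib] using add_le_add (h.col m s) (h'.col m s)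

theorem const_mul (h : SchurBound w K C) {c : ℝ} (hc : 0 ≤ c) :
    SchurBound w (fun i m => c * K i m) (c * C) where
  row i s := by
    simpa only [mul_assoc, Finset.mul_sum] using mul_le_mul_of_nonneg_left (h.row i s) hc
  col m s := by
    simpa only [mul_assoc, Finset.mul_sum] using mul_le_mul_of_nonneg_left (h.col m s) hc

theorem one [DecidableEq ι] (hw : ∀ i, 0 ≤ w i) :
    SchurBound w (fun i m => if i = m then 1 else 0) 1 where
  row i s := by
    simp only [ite_mul, one_mul, zero_mul, Finset.sum_ite_eq]
    split_ifs <;> simp [hw]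
  col m s := by
    simp only [ite_mul, one_mul, zero_mul, Finset.sum_ite_eq']
    split_ifs <;> simp [hw]

/-- The Schur test is stable under composition of kernels; `t` records the finitely many
intermediate indices that occur. -/
theorem comp [DecidableEq ι] (h : SchurBound w K C) (h' : SchurBound w K' C')
    (hK : ∀ i m, 0 ≤ K i m) (hK' : ∀ i m, 0 ≤ K' i m) (hw : ∀ i, 0 ≤ w i)
    (hC : 0 ≤ C) (hC' : 0 ≤ C') (t : ι → Finset ι) :
    SchurBound w (fun i m => ∑ p ∈ t m, K i p * K' p m) (C * C') where
  row i s := by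
    calc ∑ m ∈ s, (∑ p ∈ t m, K i p * K' p m) * w m
        ≤ ∑ m ∈ s, (∑ p ∈ s.biUnion t, K i p * K' p m) * w m := by
          refine Finset.sum_le_sum fun m hm => mul_le_mul_of_nonneg_right ?_ (hw m)
          exact Finset.sum_le_sum_of_subset_of_nonneg (Finset.subset_biUnion_of_mem t hm)
            fun p _ _ => mul_nonneg (hK _ _) (hK' _ _)
      _ = ∑ p ∈ s.biUnion t, K i p * ∑ m ∈ s, K' p m * w m := by
          simp only [Finset.sum_mul, Finset.mul_sum]
          rw [Finset.sum_comm]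
          simp only [mul_assoc]
      _ ≤ ∑ p ∈ s.biUnion t, K i p * (C' * w p) :=
          Finset.sum_le_sum fun p _ => mul_le_mul_of_nonneg_left (h'.row p s) (hK i p)
      _ = C' * ∑ p ∈ s.biUnion t, K i p * w p := by
          rw [Finset.mul_sum]
          exact Finset.sum_congr rfl fun p _ => by ring
      _ ≤ C' * (C * w i) := mul_le_mul_of_nonneg_left (h.row i _) hC'
      _ = C * C' * w i := by ring
  col m s := by
    calc ∑ i ∈ s, (∑ p ∈ t m, K i p * K' p m) * w i
        = ∑ p ∈ t m, K' p m * ∑ i ∈ s, K i p * w i := by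
          simp only [Finset.sum_mul, Finset.mul_sum]
          rw [Finset.sum_comm]
          exact Finset.sum_congr rfl fun p _ => Finset.sum_congr rfl fun i _ => by ring
      _ ≤ ∑ p ∈ t m, K' p m * (C * w p) :=
          Finset.sum_le_sum fun p _ => mul_le_mul_of_nonneg_left (h.col p s) (hK' p m)
      _ = C * ∑ p ∈ t m, K' p m * w p := by
          rw [Finset.mul_sum]
          exact Finset.sum_congr rfl fun p _ => by ring
      _ ≤ C * (C' * w m) := mul_le_mul_of_nonneg_left (h'.col m _) hC
      _ = C * C' * w m := by ring

/-- A finite sum of products over a product index set is at most the product of the sums over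
the projections. -/
theorem _root_.Finset.sum_prod_le_prod_sum_image {n : ℕ} (s : Finset (Fin n → ι)) [DecidableEq ι]
    {f : Fin n → ι → ℝ} (hf : ∀ j i, 0 ≤ f j i) :
    ∑ α ∈ s, ∏ j, f j (α j) ≤ ∏ j, ∑ i ∈ s.image (fun α => α j), f j i := by
  rw [Finset.prod_univ_sum]
  refine Finset.sum_le_sum_of_subset_of_nonneg (fun α hα => ?_)
    fun α _ _ => Finset.prod_nonneg fun j _ => hf j _
  exact Fintype.mem_piFinset.2 fun j => Finset.mem_image_of_mem _ hα

/-- The Schur test is multiplicative: tensor products of Schur bounded kernels are Schur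
bounded. -/
theorem pi {n : ℕ} {w : Fin n → ι → ℝ} {K : Fin n → ι → ι → ℝ} {C : Fin n → ℝ}
    (h : ∀ j, SchurBound (w j) (K j) (C j)) (hK : ∀ j i m, 0 ≤ K j i m) (hw : ∀ j i, 0 ≤ w j i) :
    SchurBound (fun α : Fin n → ι => ∏ j, w j (α j))
      (fun α β => ∏ j, K j (α j) (β j)) (∏ j, C j) where
  row α s := by
    classical
    simp only [← Finset.prod_mul_distrib]
    refine (s.sum_prod_le_prod_sum_image (f := fun j m => K j (α j) m * w j m)
      fun j m => mul_nonneg (hK _ _ _) (hw _ _)).trans ?_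
    exact Finset.prod_le_prod (fun j _ => Finset.sum_nonneg fun m _ =>
      mul_nonneg (hK _ _ _) (hw _ _)) fun j _ => (h j).row _ _
  col β s := by
    classical
    simp only [← Finset.prod_mul_distrib]
    refine (s.sum_prod_le_prod_sum_image (f := fun j i => K j i (β j) * w j i)
      fun j m => mul_nonneg (hK _ _ _) (hw _ _)).trans ?_
    exact Finset.prod_le_prod (fun j _ => Finset.sum_nonneg fun m _ =>
      mul_nonneg (hK _ _ _) (hw _ _)) fun j _ => (h j).col _ _

/-- The Schur test: a kernel dominated by a Schur bounded one acts boundedly on `ℓ²`. -/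
theorem sum_norm_sq_le {A : ι → ι → ℂ} (h : SchurBound w K C) (hA : ∀ i m, ‖A i m‖ ≤ K i m)
    (hw : ∀ i, 0 < w i) (hC : 0 ≤ C) (s t : Finset ι) (a : ι → ℂ) :
    ∑ i ∈ t, ‖∑ m ∈ s, a m * A i m‖ ^ 2 ≤ C ^ 2 * ∑ m ∈ s, ‖a m‖ ^ 2 := by
  have hK : ∀ i m, 0 ≤ K i m := fun i m => (norm_nonneg _).trans (hA i m)
  have key : ∀ i, ‖∑ m ∈ s, a m * A i m‖ ^ 2 ≤
      C * w i * ∑ m ∈ s, K i m * (‖a m‖ ^ 2 / w m) := by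
    intro i
    have h1 : ‖∑ m ∈ s, a m * A i m‖ ≤ ∑ m ∈ s, ‖a m‖ * K i m := by
      refine (norm_sum_le _ _).trans (Finset.sum_le_sum fun m _ => ?_)
      rw [norm_mul]
      exact mul_le_mul_of_nonneg_left (hA i m) (norm_nonneg _)
    have h2 : (∑ m ∈ s, ‖a m‖ * K i m) ^ 2 ≤
        (∑ m ∈ s, K i m * w m) * ∑ m ∈ s, K i m * (‖a m‖ ^ 2 / w m) := by
      refine Finset.sum_sq_le_sum_mul_sum_of_sq_le_mul s
        (fun m _ => mul_nonneg (hK _ _) (hw m).le)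
        (fun m _ => mul_nonneg (hK _ _) (by have := hw m; positivity)) fun m _ => ?_
      have := (hw m).ne'
      refine le_of_eq ?_
      field_simp
    refine (pow_le_pow_left₀ (norm_nonneg _) h1 2).trans (h2.trans ?_)
    refine mul_le_mul_of_nonneg_right (h.row i s) (Finset.sum_nonneg fun m _ => ?_)
    have := hw m
    have := hK i m
    positivity
  calc ∑ i ∈ t, ‖∑ m ∈ s, a m * A i m‖ ^ 2
      ≤ ∑ i ∈ t, C * w i * ∑ m ∈ s, K i m * (‖a m‖ ^ 2 / w m) :=
        Finset.sum_le_sum fun i _ => key i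
    _ = C * ∑ m ∈ s, ‖a m‖ ^ 2 / w m * ∑ i ∈ t, K i m * w i := by
        simp only [Finset.mul_sum]
        rw [Finset.sum_comm]
        exact Finset.sum_congr rfl fun p _ => Finset.sum_congr rfl fun i _ => by ring
    _ ≤ C * ∑ m ∈ s, ‖a m‖ ^ 2 / w m * (C * w m) := by
        refine mul_le_mul_of_nonneg_left (Finset.sum_le_sum fun m _ => ?_) hC
        exact mul_le_mul_of_nonneg_left (h.col m t) (by have := hw m; positivity)
    _ = C ^ 2 * ∑ m ∈ s, ‖a m‖ ^ 2 := by
        simp only [Finset.mul_sum]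
        refine Finset.sum_congr rfl fun m _ => ?_
        have := (hw m).ne'
        field_simp

end SchurBound

/-! ### Synthesis operators in a Hilbert space -/

section Hilbert

variable {ι E : Type*} [NormedAddCommGroup E] [InnerProductSpace ℂ E]

theorem norm_sum_smul_sq_of_orthonormal {e : ι → E} (he : Orthonormal ℂ e) (s : Finset ι)
    (a : ι → ℂ) : ‖∑ i ∈ s, a i • e i‖ ^ 2 = ∑ i ∈ s, ‖a i‖ ^ 2 := by
  rw [← inner_self_eq_norm_sq (𝕜 := ℂ), he.inner_sum a a s, map_sum]
  refine Finset.sum_congr rfl fun i _ => ?_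
  rw [Complex.conj_mul', ← Complex.ofReal_pow]
  exact Complex.ofReal_re _

/-- Vectors whose coordinates in an orthonormal family form a Schur bounded matrix have a
bounded synthesis operator. -/
theorem norm_sum_smul_sq_le_of_schurBound {e H : ι → E} (he : Orthonormal ℂ e)
    {w : ι → ℝ} {K : ι → ι → ℝ} {C : ℝ} (hK : SchurBound w K C) (hw : ∀ i, 0 < w i) (hC : 0 ≤ C)
    {A : ι → ι → ℂ} (hA : ∀ i m, ‖A i m‖ ≤ K i m) {t : ι → Finset ι}
    (ht : ∀ m, ∀ i ∉ t m, A i m = 0) (hH : ∀ m, H m = ∑ i ∈ t m, A i m • e i)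
    (s : Finset ι) (a : ι → ℂ) :
    ‖∑ m ∈ s, a m • H m‖ ^ 2 ≤ C ^ 2 * ∑ m ∈ s, ‖a m‖ ^ 2 := by
  classical
  have h1 : ∑ m ∈ s, a m • H m = ∑ i ∈ s.biUnion t, (∑ m ∈ s, a m * A i m) • e i := by
    simp only [Finset.sum_smul]
    rw [Finset.sum_comm]
    refine Finset.sum_congr rfl fun m hm => ?_
    rw [hH, Finset.smul_sum]
    simp only [smul_smul]
    refine Finset.sum_subset (Finset.subset_biUnion_of_mem t hm) fun i _ hi => ?_
    rw [ht m i hi, mul_zero, zero_smul]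
  rw [h1, norm_sum_smul_sq_of_orthonormal he]
  exact hK.sum_norm_sq_le hA hw hC s _ a

/-- If finite combinations of the vectors `H α` are controlled by the `ℓ²` norm of the
coefficients, then `f ↦ ∑ ⟨φ_α, f⟩ H_α` is a bounded operator for every orthonormal family `φ`,
complete or not. -/
theorem exists_clm_hasSum [CompleteSpace E] {φ H : ι → E} (hφ : Orthonormal ℂ φ) {C : ℝ}
    (hC : 0 ≤ C)
    (hH : ∀ (s : Finset ι) (a : ι → ℂ), ‖∑ α ∈ s, a α • H α‖ ^ 2 ≤ C ^ 2 * ∑ α ∈ s, ‖a α‖ ^ 2) :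
    ∃ T : E →L[ℂ] E, ∀ f, HasSum (fun α => inner ℂ (φ α) f • H α) (T f) := by
  have hsum : ∀ f, Summable fun α => inner ℂ (φ α) f • H α := by
    intro f
    rw [summable_iff_vanishing_norm]
    intro ε hε
    obtain ⟨s, hs⟩ := summable_iff_vanishing_norm.1 (hφ.inner_products_summable (x := f))
      (ε ^ 2 / (C ^ 2 + 1)) (by positivity)
    refine ⟨s, fun t ht => ?_⟩
    have h1 := hH t fun α => inner ℂ (φ α) f
    have h2 := hs t ht
    rw [Real.norm_of_nonneg (Finset.sum_nonneg fun _ _ => by positivity)] at h2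
    refine lt_of_pow_lt_pow_left₀ 2 hε.le (h1.trans_lt ?_)
    rw [lt_div_iff₀ (by positivity)] at h2
    have : 0 ≤ ∑ α ∈ t, ‖inner ℂ (φ α) f‖ ^ 2 := Finset.sum_nonneg fun _ _ => by positivity
    nlinarith
  let T₀ : E →ₗ[ℂ] E :=
    { toFun := fun f => ∑' α, inner ℂ (φ α) f • H α
      map_add' := fun f g => by
        simp only [inner_add_right, add_smul]
        exact (hsum f).tsum_add (hsum g)
      map_smul' := fun c f => by
        simp only [inner_smul_right, mul_smul, RingHom.id_apply]
        exact (hsum f).tsum_const_smul c }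
  refine ⟨T₀.mkContinuous C fun f => ?_, fun f => (hsum f).hasSum⟩
  refine le_of_tendsto ((hsum f).hasSum.norm) (Filter.Eventually.of_forall fun s => ?_)
  refine le_of_sq_le_sq ?_ (by positivity)
  rw [mul_pow]
  exact (hH s _).trans (mul_le_mul_of_nonneg_left (hφ.sum_inner_products_le f) (by positivity))

end Hilbert

/-! ### Laguerre polynomials -/

/-- The absolute value of the coefficient of `x ^ i` in the Laguerre polynomial of degree `m` and
order `a`. It is set to zero for `i > m`, where the truncated difference `m - i` in the formula
would be meaningless. -/
def laguerreCoeff (a : ℝ) (m i : ℕ) : ℝ :=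
  if i ≤ m then Real.Gamma (m + a + 1) / Real.Gamma (i + a + 1) / (i.factorial * (m - i).factorial)
  else 0

theorem laguerreCoeff_of_lt (a : ℝ) {m i : ℕ} (h : m < i) : laguerreCoeff a m i = 0 :=
  if_neg h.not_ge

theorem laguerrePoly_eq_sum (a : ℝ) {m N : ℕ} (h : m < N) (x : ℝ) :
    laguerrePoly a m x = ∑ i ∈ Finset.range N, laguerreCoeff a m i * (-x) ^ i := by
  rw [laguerrePoly, ← Finset.sum_subset (Finset.range_mono (Nat.succ_le_of_lt h))]
  · refine Finset.sum_congr rfl fun i hi => ?_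
    rw [laguerreCoeff, if_pos (Finset.mem_range_succ_iff.1 hi)]
  · intro i _ hi
    rw [laguerreCoeff_of_lt a (by simpa using hi), zero_mul]

theorem gamma_nat_add_pos {a : ℝ} (ha : -1 < a) (m : ℕ) : 0 < Real.Gamma (m + a + 1) :=
  Real.Gamma_pos_of_pos (by have : (0 : ℝ) ≤ m := m.cast_nonneg; linarith)

theorem gamma_nat_add_succ {a : ℝ} (ha : -1 < a) (m : ℕ) :
    Real.Gamma (m + (a + 1) + 1) = (m + a + 1) * Real.Gamma (m + a + 1) := by
  rw [← Real.Gamma_add_one (by have : (0 : ℝ) ≤ m := m.cast_nonneg; linarith)]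
  ring_nf

theorem gamma_succ_nat_add {a : ℝ} (ha : -1 < a) (m : ℕ) :
    Real.Gamma ((m + 1 : ℕ) + a + 1) = (m + a + 1) * Real.Gamma (m + a + 1) := by
  rw [← gamma_nat_add_succ ha]
  push_cast
  ring_nf

theorem laguerreCoeff_zero_zero {a : ℝ} (ha : -1 < a) : laguerreCoeff a 0 0 = 1 := by
  have := (gamma_nat_add_pos ha 0).ne'
  simp only [laguerreCoeff, le_refl, if_true, Nat.factorial_zero, Nat.sub_self, Nat.cast_one,
    mul_one, div_one]
  exact div_self this

theorem succ_mul_laguerreCoeff_succ (a : ℝ) (m i : ℕ) :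
    (i + 1) * laguerreCoeff a (m + 1) (i + 1) = laguerreCoeff (a + 1) m i := by
  simp only [laguerreCoeff, add_le_add_iff_right, Nat.add_sub_add_right]
  split_ifs with h
  · have h1 : (((m + 1 : ℕ) : ℝ) + a + 1) = m + (a + 1) + 1 := by push_cast; ring
    have h2 : (((i + 1 : ℕ) : ℝ) + a + 1) = i + (a + 1) + 1 := by push_cast; ring
    rw [h1, h2, Nat.factorial_succ]
    push_cast
    have : (i : ℝ) + 1 ≠ 0 := by positivity
    have : ((m - i).factorial : ℝ) ≠ 0 := by positivity
    have : (i.factorial : ℝ) ≠ 0 := by positivity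
    field_simp
  · simp

theorem laguerreCoeff_succ_order {a : ℝ} (ha : -1 < a) (m i : ℕ) :
    (m + a + 1) * laguerreCoeff a m i = (i + a + 1) * laguerreCoeff (a + 1) m i := by
  simp only [laguerreCoeff]
  split_ifs with h
  · rw [gamma_nat_add_succ ha, gamma_nat_add_succ ha]
    have := (gamma_nat_add_pos ha i).ne'
    have : (i : ℝ) + a + 1 ≠ 0 := by have : (0 : ℝ) ≤ i := i.cast_nonneg; linarith
    have : ((m - i).factorial : ℝ) ≠ 0 := by positivity
    have : (i.factorial : ℝ) ≠ 0 := by positivity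
    field_simp
  · simp

theorem laguerreCoeff_succ_degree {a : ℝ} (ha : -1 < a) (m i : ℕ) :
    (m + 1 - i) * laguerreCoeff a (m + 1) i = (m + a + 1) * laguerreCoeff a m i := by
  rcases lt_trichotomy i (m + 1) with h | rfl | h
  · have h' : i ≤ m := Nat.lt_succ_iff.1 h
    simp only [laguerreCoeff, h', h.le, if_true]
    rw [gamma_succ_nat_add ha, Nat.sub_add_comm h', Nat.factorial_succ]
    have := (gamma_nat_add_pos ha i).ne'
    have : ((m - i).factorial : ℝ) ≠ 0 := by positivity
    have : (i.factorial : ℝ) ≠ 0 := by positivity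
    have h3 : (((m - i + 1 : ℕ)) : ℝ) = m + 1 - i := by
      rw [Nat.cast_add, Nat.cast_sub h']; push_cast; ring
    have : (m : ℝ) + 1 - i ≠ 0 := by rw [← h3]; positivity
    push_cast at h3 ⊢
    rw [h3]
    field_simp
  · rw [laguerreCoeff_of_lt a (Nat.lt_succ_self m)]
    push_cast
    ring
  · rw [laguerreCoeff_of_lt a h, laguerreCoeff_of_lt a (by omega)]
    ring

theorem laguerreCoeff_sub {a : ℝ} (ha : -1 < a) (m i : ℕ) :
    laguerreCoeff (a + 1) (m + 1) i - laguerreCoeff (a + 1) m i = laguerreCoeff a (m + 1) i := by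
  have h1 := laguerreCoeff_succ_order ha (m + 1) i
  have h2 := laguerreCoeff_succ_degree (a := a + 1) (by linarith) m i
  have h0 : (m : ℝ) + a + 2 ≠ 0 := by have : (0 : ℝ) ≤ m := m.cast_nonneg; linarith
  push_cast at h1
  apply mul_left_cancel₀ h0
  linear_combination -h1 + h2

/-- The coefficient form of the identity for `(x L_m^{a+1}(x²))'`. -/
theorem odd_mul_laguerreCoeff {a : ℝ} (ha : -1 < a) (m i : ℕ) :
    (2 * i + 1) * laguerreCoeff (a + 1) (m + 1) i =
      (2 * m + 3) * laguerreCoeff a (m + 1) i - (2 * a + 1) * laguerreCoeff (a + 1) m i := by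
  have h1 := laguerreCoeff_succ_order ha (m + 1) i
  have h2 := laguerreCoeff_succ_degree (a := a + 1) (by linarith) m i
  have h0 : (m : ℝ) + a + 2 ≠ 0 := by have : (0 : ℝ) ≤ m := m.cast_nonneg; linarith
  push_cast at h1
  -- after multiplication by `m + a + 2` every coefficient is a multiple of that of `L_{m+1}^{a+1}`
  apply mul_left_cancel₀ h0
  linear_combination -(2 * m + 3) * h1 - (2 * a + 1) * h2

theorem laguerrePoly_zero {a : ℝ} (ha : -1 < a) (x : ℝ) : laguerrePoly a 0 x = 1 := by
  simp [laguerrePoly_eq_sum a (Nat.lt_succ_self 0), laguerreCoeff_zero_zero ha]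

theorem laguerrePoly_sub {a : ℝ} (ha : -1 < a) (m : ℕ) (x : ℝ) :
    laguerrePoly (a + 1) (m + 1) x - laguerrePoly (a + 1) m x = laguerrePoly a (m + 1) x := by
  rw [laguerrePoly_eq_sum _ (show m < m + 2 by omega), laguerrePoly_eq_sum _ (Nat.lt_succ_self _),
    laguerrePoly_eq_sum _ (Nat.lt_succ_self _), ← Finset.sum_sub_distrib]
  exact Finset.sum_congr rfl fun i _ => by rw [← laguerreCoeff_sub ha]; ring

theorem laguerrePoly_succ_order {a : ℝ} (ha : -1 < a) (m : ℕ) (x : ℝ) :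
    laguerrePoly (a + 1) m x = ∑ i ∈ Finset.range (m + 1), laguerrePoly a i x := by
  induction m with
  | zero => simp [laguerrePoly_zero ha, laguerrePoly_zero (a := a + 1) (by linarith)]
  | succ m ih => rw [Finset.sum_range_succ, ← ih, ← laguerrePoly_sub ha]; ring

theorem hasDerivAt_laguerrePoly_succ (a : ℝ) (m : ℕ) (x : ℝ) :
    HasDerivAt (laguerrePoly a (m + 1)) (-laguerrePoly (a + 1) m x) x := by
  have h0 : laguerrePoly a (m + 1) = fun x =>
      ∑ i ∈ Finset.range (m + 2), laguerreCoeff a (m + 1) i * (-x) ^ i :=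
    funext fun x => laguerrePoly_eq_sum a (Nat.lt_succ_self _) x
  rw [h0]
  have h1 : HasDerivAt (fun x : ℝ => ∑ i ∈ Finset.range (m + 2),
      laguerreCoeff a (m + 1) i * (-x) ^ i)
      (∑ i ∈ Finset.range (m + 2), laguerreCoeff a (m + 1) i * (i * (-x) ^ (i - 1) * (-1))) x :=
    HasDerivAt.fun_sum fun i _ => (((hasDerivAt_id x).fun_neg.fun_pow i).const_mul _)
  convert h1 using 1
  rw [laguerrePoly_eq_sum _ (Nat.lt_succ_self m), Finset.sum_range_succ' _ (m + 1),
    ← Finset.sum_neg_distrib]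
  simp only [Nat.cast_zero, zero_mul, mul_zero, add_zero]
  refine Finset.sum_congr rfl fun i _ => ?_
  rw [← succ_mul_laguerreCoeff_succ]
  push_cast
  ring

theorem hasDerivAt_mul_laguerrePoly_sq {a : ℝ} (ha : -1 < a) (m : ℕ) (x : ℝ) :
    HasDerivAt (fun x => x * laguerrePoly (a + 1) m (x ^ 2))
      ((2 * m + 1) * laguerrePoly a m (x ^ 2)
        - (2 * a + 1) * ∑ i ∈ Finset.range m, laguerrePoly a i (x ^ 2)) x := by
  have h0 : (fun x => x * laguerrePoly (a + 1) m (x ^ 2)) = fun x =>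
      ∑ i ∈ Finset.range (m + 1), laguerreCoeff (a + 1) m i * (-1) ^ i * x ^ (2 * i + 1) := by
    funext x
    rw [laguerrePoly_eq_sum _ (Nat.lt_succ_self m), Finset.mul_sum]
    refine Finset.sum_congr rfl fun i _ => ?_
    rw [neg_pow (x ^ 2), ← pow_mul]
    ring
  rw [h0]
  have h1 : HasDerivAt (fun x : ℝ => ∑ i ∈ Finset.range (m + 1),
      laguerreCoeff (a + 1) m i * (-1) ^ i * x ^ (2 * i + 1))
      (∑ i ∈ Finset.range (m + 1), laguerreCoeff (a + 1) m i * (-1) ^ i *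
        ((2 * i + 1 : ℕ) * x ^ (2 * i))) x :=
    HasDerivAt.fun_sum fun i _ => (hasDerivAt_pow _ x).const_mul _
  convert h1 using 1
  have h2 : ∀ i : ℕ, laguerreCoeff (a + 1) m i * (-1) ^ i * ((2 * i + 1 : ℕ) * x ^ (2 * i)) =
      (2 * i + 1) * laguerreCoeff (a + 1) m i * (-x ^ 2) ^ i := by
    intro i
    rw [neg_pow (x ^ 2), ← pow_mul]
    push_cast
    ring
  simp only [h2]
  rcases m with _ | m
  · simp [laguerrePoly_zero ha, laguerreCoeff_zero_zero (a := a + 1) (by linarith)]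
  · rw [← laguerrePoly_succ_order ha, laguerrePoly_eq_sum _ (Nat.lt_succ_self _),
      laguerrePoly_eq_sum _ (show m < m + 2 by omega), Finset.mul_sum, Finset.mul_sum,
      ← Finset.sum_sub_distrib]
    refine Finset.sum_congr rfl fun i _ => ?_
    rw [odd_mul_laguerreCoeff ha]
    push_cast
    ring

/-! ### The action of `δ` on Laguerre functions -/

/-- `G = δ F` on `(0, ∞)` for the operator `δ = d/dx + x - (a + 1/2) / x`, stated as a formula for
the derivative of `F`. -/
def IsDelta (a : ℝ) (F G : ℝ → ℝ) : Prop :=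
  ∀ x, 0 < x → HasDerivAt F (G x - (x - 1 / x * (a + 1 / 2)) * F x) x

theorem IsDelta.congr {a : ℝ} {F F' G G' : ℝ → ℝ} (h : IsDelta a F G)
    (hF : ∀ x, 0 < x → F' x = F x) (hG : ∀ x, 0 < x → G' x = G x) : IsDelta a F' G' := by
  intro x hx
  rw [hF x hx, hG x hx]
  refine (h x hx).congr_of_eventuallyEq ?_
  filter_upwards [Ioi_mem_nhds hx] with y hy using hF y hy

theorem IsDelta.const_mul {a : ℝ} {F G : ℝ → ℝ} (h : IsDelta a F G) (c : ℝ) :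
    IsDelta a (fun x => c * F x) (fun x => c * G x) := by
  intro x hx
  exact ((h x hx).const_mul c).congr_deriv (by ring)

theorem IsDelta.sum {ι : Type*} {a : ℝ} {F G : ι → ℝ → ℝ} (s : Finset ι)
    (h : ∀ i ∈ s, IsDelta a (F i) (G i)) :
    IsDelta a (fun x => ∑ i ∈ s, F i x) (fun x => ∑ i ∈ s, G i x) := by
  intro x hx
  refine (HasDerivAt.fun_sum fun i hi => h i hi x hx).congr_deriv ?_
  rw [Finset.sum_sub_distrib, Finset.mul_sum]

/-- The operator `δ` acts as `d/dx` on the first factor of `P(x) x^{a+1/2} e^{-x²/2}`. -/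
theorem isDelta_mul_rpow_mul_exp (a : ℝ) {P P' : ℝ → ℝ}
    (hP : ∀ x, 0 < x → HasDerivAt P (P' x) x) :
    IsDelta a (fun x => P x * x ^ (a + 1 / 2) * Real.exp (-x ^ 2 / 2))
      (fun x => P' x * x ^ (a + 1 / 2) * Real.exp (-x ^ 2 / 2)) := by
  intro x hx
  have h1 : HasDerivAt (fun x : ℝ => x ^ (a + 1 / 2)) ((a + 1 / 2) * x ^ (a + 1 / 2 - 1)) x :=
    Real.hasDerivAt_rpow_const (Or.inl hx.ne')
  have h2 : HasDerivAt (fun x : ℝ => Real.exp (-x ^ 2 / 2)) (Real.exp (-x ^ 2 / 2) * (-x)) x := by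
    refine ((hasDerivAt_pow 2 x).fun_neg.div_const 2).exp.congr_deriv ?_
    push_cast
    ring
  refine (((hP x hx).fun_mul h1).fun_mul h2).congr_deriv ?_
  rw [Real.rpow_sub_one hx.ne']
  field_simp
  ring

/-- The constant that normalizes the Laguerre function of order `a` and index `m`. -/
def laguerreNorm (a : ℝ) (m : ℕ) : ℝ :=
  Real.sqrt (2 * Real.Gamma (m + 1) / Real.Gamma (m + a + 1))

theorem laguerreNorm_pos {a : ℝ} (ha : -1 < a) (m : ℕ) : 0 < laguerreNorm a m := by
  have := gamma_nat_add_pos ha m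
  have : 0 < Real.Gamma (m + 1) := Real.Gamma_pos_of_pos (by positivity)
  unfold laguerreNorm
  positivity

theorem laguerreNorm_sq {a : ℝ} (ha : -1 < a) (m : ℕ) :
    laguerreNorm a m ^ 2 = 2 * Real.Gamma (m + 1) / Real.Gamma (m + a + 1) := by
  have := gamma_nat_add_pos ha m
  have : 0 < Real.Gamma (m + 1) := Real.Gamma_pos_of_pos (by positivity)
  exact Real.sq_sqrt (by positivity)

theorem laguerreNorm_succ_order_sq {a : ℝ} (ha : -1 < a) (m : ℕ) :
    laguerreNorm a m ^ 2 = (m + a + 1) * laguerreNorm (a + 1) m ^ 2 := by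
  rw [laguerreNorm_sq ha, laguerreNorm_sq (by linarith), gamma_nat_add_succ ha]
  have := (gamma_nat_add_pos ha m).ne'
  have : (m : ℝ) + a + 1 ≠ 0 := by have : (0 : ℝ) ≤ m := m.cast_nonneg; linarith
  field_simp

theorem laguerreNorm_succ_sq {a : ℝ} (ha : -1 < a) (m : ℕ) :
    laguerreNorm a (m + 1) ^ 2 = (m + 1) * laguerreNorm (a + 1) m ^ 2 := by
  rw [laguerreNorm_sq ha, laguerreNorm_sq (by linarith), gamma_succ_nat_add ha,
    gamma_nat_add_succ ha]
  push_cast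
  rw [Real.Gamma_add_one (by positivity)]
  ring

theorem laguerreNorm_succ {a : ℝ} (ha : -1 < a) (m : ℕ) :
    laguerreNorm a (m + 1) = Real.sqrt (m + 1) * laguerreNorm (a + 1) m := by
  have := laguerreNorm_pos (a := a + 1) (by linarith) m
  rw [← sq_eq_sq₀ (laguerreNorm_pos ha _).le (by positivity), laguerreNorm_succ_sq ha, mul_pow,
    Real.sq_sqrt (by positivity)]

theorem laguerreFun1_eq (a : ℝ) (m : ℕ) (x : ℝ) :
    laguerreFun1 a m x =
      laguerreNorm a m * (laguerrePoly a m (x ^ 2) * x ^ (a + 1 / 2) * Real.exp (-x ^ 2 / 2)) := by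
  rw [laguerreFun1, laguerreNorm]
  ring

theorem laguerreFun1_succ_order_eq (a : ℝ) (m : ℕ) {x : ℝ} (hx : 0 < x) :
    laguerreFun1 (a + 1) m x = laguerreNorm (a + 1) m *
      (x * laguerrePoly (a + 1) m (x ^ 2) * x ^ (a + 1 / 2) * Real.exp (-x ^ 2 / 2)) := by
  rw [laguerreFun1_eq, show a + 1 + 1 / 2 = a + 1 / 2 + 1 by ring, Real.rpow_add_one hx.ne']
  ring

theorem isDelta_laguerreFun1_zero {a : ℝ} (ha : -1 < a) :
    IsDelta a (laguerreFun1 a 0) (fun _ => 0) := by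
  refine ((isDelta_mul_rpow_mul_exp a (P := fun _ => 1) (P' := fun _ => 0)
    fun x _ => hasDerivAt_const x 1).const_mul (laguerreNorm a 0)).congr (fun x _ => ?_)
    fun x _ => by ring
  rw [laguerreFun1_eq, laguerrePoly_zero ha]

theorem isDelta_laguerreFun1_succ {a : ℝ} (ha : -1 < a) (m : ℕ) :
    IsDelta a (laguerreFun1 a (m + 1))
      (fun x => -2 * Real.sqrt (m + 1) * laguerreFun1 (a + 1) m x) := by
  refine ((isDelta_mul_rpow_mul_exp a (P := fun x => laguerrePoly a (m + 1) (x ^ 2))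
    (P' := fun x => -laguerrePoly (a + 1) m (x ^ 2) * (2 * x)) fun x _ => ?_).const_mul
    (laguerreNorm a (m + 1))).congr (fun x _ => laguerreFun1_eq _ _ _) fun x hx => ?_
  · have := (hasDerivAt_laguerrePoly_succ a m (x ^ 2)).comp x (hasDerivAt_pow 2 x)
    exact this.congr_deriv (by simp)
  · rw [laguerreFun1_succ_order_eq a m hx, laguerreNorm_succ ha]
    ring

/-- The matrix of `δ : span φ^a → span φ^{a+1}`. -/
def evenStep (i m : ℕ) : ℝ := if i + 1 = m then -2 * Real.sqrt m else 0

/-- The matrix of `δ : span φ^{a+1} → span φ^a`, where `δ` is the operator of order `a`. -/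
def oddStep (a : ℝ) (i m : ℕ) : ℝ :=
  if i = m then (2 * m + 1) * (laguerreNorm (a + 1) m / laguerreNorm a m)
  else if i < m then -(2 * a + 1) * (laguerreNorm (a + 1) m / laguerreNorm a i) else 0

theorem isDelta_laguerreFun1_even {a : ℝ} (ha : -1 < a) (m : ℕ) :
    IsDelta a (laguerreFun1 a m)
      (fun x => ∑ i ∈ Finset.range (m + 1), evenStep i m * laguerreFun1 (a + 1) i x) := by
  rcases m with _ | m
  · refine (isDelta_laguerreFun1_zero ha).congr (fun _ _ => rfl) fun x _ => ?_
    simp [evenStep]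
  · refine (isDelta_laguerreFun1_succ ha m).congr (fun _ _ => rfl) fun x _ => ?_
    rw [Finset.sum_eq_single m]
    · simp [evenStep]
    · intro i _ hi
      simp [evenStep, hi]
    · intro h
      exact absurd (Finset.mem_range.2 (by omega)) h

theorem isDelta_laguerreFun1_odd {a : ℝ} (ha : -1 < a) (m : ℕ) :
    IsDelta a (laguerreFun1 (a + 1) m)
      (fun x => ∑ i ∈ Finset.range (m + 1), oddStep a i m * laguerreFun1 a i x) := by
  refine ((isDelta_mul_rpow_mul_exp a (P := fun x => x * laguerrePoly (a + 1) m (x ^ 2))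
    fun x _ => hasDerivAt_mul_laguerrePoly_sq ha m x).const_mul
    (laguerreNorm (a + 1) m)).congr (fun x hx => laguerreFun1_succ_order_eq _ _ hx) fun x _ => ?_
  have h : ∀ i ∈ Finset.range m, oddStep a i m * laguerreFun1 a i x =
      -(2 * a + 1) * laguerreNorm (a + 1) m * (x ^ (a + 1 / 2) * Real.exp (-x ^ 2 / 2)) *
        laguerrePoly a i (x ^ 2) := by
    intro i hi
    have hi := Finset.mem_range.1 hi
    have := (laguerreNorm_pos ha i).ne'
    rw [oddStep, if_neg hi.ne, if_pos hi, laguerreFun1_eq]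
    field_simp
  have := (laguerreNorm_pos ha m).ne'
  rw [Finset.sum_range_succ, Finset.sum_congr rfl h, ← Finset.mul_sum, oddStep, if_pos rfl,
    laguerreFun1_eq]
  field_simp
  ring

/-- The matrix of `δ` on the Laguerre functions reached after `p` applications of `δ`, whose order
is `a` for even `p` and `a + 1` for odd `p`. -/
def stepMatrix (a : ℝ) (p i m : ℕ) : ℝ := if p % 2 = 0 then evenStep i m else oddStep a i m

theorem stepMatrix_of_lt (a : ℝ) (p : ℕ) {i m : ℕ} (h : m < i) : stepMatrix a p i m = 0 := by
  simp only [stepMatrix, evenStep, oddStep]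
  rw [if_neg (show i + 1 ≠ m by omega), if_neg h.ne', if_neg h.not_gt, ite_self]

theorem isDelta_laguerreFun1 {a : ℝ} (ha : -1 < a) (p m : ℕ) :
    IsDelta a (laguerreFun1 (a + (p % 2 : ℕ)) m) (fun x => ∑ i ∈ Finset.range (m + 1),
      stepMatrix a p i m * laguerreFun1 (a + ((p + 1) % 2 : ℕ)) i x) := by
  rcases Nat.mod_two_eq_zero_or_one p with h | h
  · have h' : (p + 1) % 2 = 1 := by omega
    simpa [stepMatrix, h, h'] using isDelta_laguerreFun1_even ha m
  · have h' : (p + 1) % 2 = 0 := by omega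
    simpa [stepMatrix, h, h'] using isDelta_laguerreFun1_odd ha m

/-- The matrix of `δ^p`: column `m` holds the coordinates of `δ^p φ_m^a` in the Laguerre functions
of order `a` or `a + 1`, according to the parity of `p`. -/
def deltaMatrix (a : ℝ) : ℕ → ℕ → ℕ → ℝ
  | 0, i, m => if i = m then 1 else 0
  | p + 1, i, m => ∑ q ∈ Finset.range (m + 1), stepMatrix a p i q * deltaMatrix a p q m

theorem deltaMatrix_of_lt (a : ℝ) (p : ℕ) {i m : ℕ} (h : m < i) : deltaMatrix a p i m = 0 := by
  rcases p with _ | p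
  · exact if_neg h.ne'
  · refine Finset.sum_eq_zero fun q hq => ?_
    rw [stepMatrix_of_lt a p ((Finset.mem_range_succ_iff.1 hq).trans_lt h), zero_mul]

/-- The function `δ^p φ_m^a`. -/
def deltaFun (a : ℝ) (m p : ℕ) (x : ℝ) : ℝ :=
  ∑ i ∈ Finset.range (m + 1), deltaMatrix a p i m * laguerreFun1 (a + (p % 2 : ℕ)) i x

theorem deltaFun_zero (a : ℝ) (m : ℕ) : deltaFun a m 0 = laguerreFun1 a m := by
  funext x
  rw [deltaFun, Finset.sum_eq_single m]
  · simp [deltaMatrix]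
  · intro i _ hi
    simp [deltaMatrix, hi]
  · simp

theorem isDelta_deltaFun {a : ℝ} (ha : -1 < a) (m p : ℕ) :
    IsDelta a (deltaFun a m p) (deltaFun a m (p + 1)) := by
  refine (IsDelta.sum (Finset.range (m + 1)) fun q _ =>
    (isDelta_laguerreFun1 ha p q).const_mul (deltaMatrix a p q m)).congr (fun _ _ => rfl)
    fun x _ => ?_
  simp only [deltaFun, deltaMatrix, Finset.sum_mul]
  rw [Finset.sum_comm]
  refine Finset.sum_congr rfl fun q hq => ?_
  rw [Finset.mul_sum]
  symm
  refine (Finset.sum_subset (Finset.range_mono (Finset.mem_range.1 hq)) fun i _ hi => ?_).trans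
    (Finset.sum_congr rfl fun i _ => by ring)
  rw [stepMatrix_of_lt a p (by simpa using hi)]
  ring

/-! ### Schur bounds for the matrices of `δ^p` -/

/-- The discrete Hardy kernel `b_i b_m / σ_m²`, `i ≤ m`, where `σ_m²` is proportional to
`∑_{i ≤ m} b_i²`, passes the Schur test with weight `b_i / σ_i`: both sums telescope, in `σ` and
in `1 / σ`. -/
theorem schurBound_hardy {b σ : ℕ → ℝ} {c : ℝ} (hc : 0 < c) (hb : ∀ m, 0 < b m)
    (hσ : ∀ m, 0 < σ m) (h0 : c * b 0 ^ 2 = σ 0 ^ 2)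
    (hS : ∀ m, c * b (m + 1) ^ 2 = σ (m + 1) ^ 2 - σ m ^ 2) :
    SchurBound (fun i => b i / σ i) (fun i m => if i ≤ m then b i * b m / σ m ^ 2 else 0)
      (3 / c) := by
  have hmono : ∀ m, σ m ≤ σ (m + 1) := fun m => by
    have := hS m
    have h1 : σ m ^ 2 ≤ σ (m + 1) ^ 2 := by have := hb (m + 1); nlinarith [sq_nonneg (b (m + 1))]
    exact le_of_sq_le_sq h1 (hσ _).le
  have hle : ∀ m, c * b m ^ 2 ≤ σ m ^ 2 := by
    rintro (_ | m)
    · exact h0.le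
    · rw [hS]; linarith [sq_nonneg (σ m)]
  have hrow : ∀ i N, i ≤ N →
      ∑ m ∈ Finset.Ico i (N + 1), c * b m ^ 2 / σ m ^ 3 ≤ 3 / σ i - 2 / σ N := by
    intro i N hN
    induction N, hN using Nat.le_induction with
    | base =>
      have := hσ i
      simp only [Nat.Ico_succ_singleton, Finset.sum_singleton]
      rw [← sub_div, div_le_div_iff₀ (by positivity) this]
      nlinarith [mul_le_mul_of_nonneg_right (hle i) this.le]
    | succ N hN ih =>
      rw [Finset.sum_Ico_succ_top (by omega)]
      have h1 := hσ N
      have h2 := hσ (N + 1)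
      have h3 := hmono N
      have : c * b (N + 1) ^ 2 / σ (N + 1) ^ 3 ≤ 2 / σ N - 2 / σ (N + 1) := by
        rw [hS, div_sub_div _ _ h1.ne' h2.ne', div_le_div_iff₀ (by positivity) (by positivity)]
        have h4 : 0 ≤ (σ (N + 1) - σ N) * σ (N + 1) :=
          mul_nonneg (sub_nonneg.2 h3) h2.le
        have h5 : (σ (N + 1) + σ N) * σ N ≤ 2 * σ (N + 1) ^ 2 := by nlinarith
        nlinarith [mul_le_mul_of_nonneg_left h5 h4]
      linarith
  have hcol : ∀ m, ∑ i ∈ Finset.range (m + 1), c * b i ^ 2 / σ i ≤ 2 * σ m := by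
    intro m
    induction m with
    | zero =>
      have := hσ 0
      simp only [zero_add, Finset.sum_range_one]
      rw [h0, div_le_iff₀ this]
      nlinarith
    | succ m ih =>
      rw [Finset.sum_range_succ]
      have h1 := hσ m
      have h2 := hσ (m + 1)
      have h3 := hmono m
      have : c * b (m + 1) ^ 2 / σ (m + 1) ≤ 2 * σ (m + 1) - 2 * σ m := by
        rw [hS, div_le_iff₀ h2]
        nlinarith
      linarith
  constructor
  · intro i s
    have hi := hb i
    -- an upper bound for the finitely many columns that occur
    set N := max i (s.sup id)
    have h1 : ∑ m ∈ s, (if i ≤ m then b i * b m / σ m ^ 2 else 0) * (b m / σ m) ≤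
        ∑ m ∈ Finset.Ico i (N + 1), b i / c * (c * b m ^ 2 / σ m ^ 3) := by
      simp only [ite_mul, zero_mul]
      rw [← Finset.sum_filter]
      calc _ = ∑ m ∈ s.filter (i ≤ ·), b i / c * (c * b m ^ 2 / σ m ^ 3) := by
            refine Finset.sum_congr rfl fun m _ => ?_
            have := (hσ m).ne'
            field_simp
        _ ≤ _ := by
            refine Finset.sum_le_sum_of_subset_of_nonneg (fun m hm => ?_) fun m _ _ => ?_
            · obtain ⟨hm, him⟩ := Finset.mem_filter.1 hm
              have := Finset.le_sup (f := id) hm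
              exact Finset.mem_Ico.2 ⟨him, Nat.lt_succ_iff.2 (le_max_of_le_right this)⟩
            · have := hb m
              have := hσ m
              positivity
    refine h1.trans ?_
    rw [← Finset.mul_sum]
    have h2 : ∑ m ∈ Finset.Ico i (N + 1), c * b m ^ 2 / σ m ^ 3 ≤ 3 / σ i :=
      (hrow i N (le_max_left _ _)).trans (sub_le_self _ (by have := hσ N; positivity))
    calc _ ≤ b i / c * (3 / σ i) := mul_le_mul_of_nonneg_left h2 (by positivity)
      _ = _ := by ring
  · intro m s
    have hm := hb m
    have hm' := hσ m
    have h1 : ∑ i ∈ s, (if i ≤ m then b i * b m / σ m ^ 2 else 0) * (b i / σ i) ≤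
        ∑ i ∈ Finset.range (m + 1), b m / σ m ^ 2 / c * (c * b i ^ 2 / σ i) := by
      simp only [ite_mul, zero_mul]
      rw [← Finset.sum_filter]
      calc _ = ∑ i ∈ s.filter (· ≤ m), b m / σ m ^ 2 / c * (c * b i ^ 2 / σ i) := by
            refine Finset.sum_congr rfl fun i _ => ?_
            have := (hσ i).ne'
            field_simp
        _ ≤ _ := by
            refine Finset.sum_le_sum_of_subset_of_nonneg (fun i hi => ?_) fun i _ _ => ?_
            · exact Finset.mem_range_succ_iff.2 (Finset.mem_filter.1 hi).2
            · have := hb i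
              have := hσ i
              positivity
    refine h1.trans ?_
    rw [← Finset.mul_sum]
    calc _ ≤ b m / σ m ^ 2 / c * (3 * σ m) :=
          mul_le_mul_of_nonneg_left ((hcol m).trans (by linarith)) (by positivity)
      _ = _ := by field_simp

/-- The weight for which all the matrices below pass the Schur test. -/
def schurWeight (a : ℝ) (i : ℕ) : ℝ := (Real.sqrt (i + a + 1))⁻¹

/-- The eigenvalue of the one-dimensional Laguerre operator to the power `-1/2`. -/
def eigenvalueInvSqrt (a : ℝ) (m : ℕ) : ℝ := (Real.sqrt (4 * m + 2 * a + 2))⁻¹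

section

variable {a : ℝ}

theorem schurWeight_pos (ha : -1 < a) (i : ℕ) : 0 < schurWeight a i := by
  have : 0 < (i : ℝ) + a + 1 := by have : (0 : ℝ) ≤ i := i.cast_nonneg; linarith
  unfold schurWeight
  positivity

theorem eigenvalueInvSqrt_nonneg (a : ℝ) (m : ℕ) : 0 ≤ eigenvalueInvSqrt a m :=
  inv_nonneg.2 (Real.sqrt_nonneg _)

theorem eigenvalueInvSqrt_anti (ha : -1 < a) {i m : ℕ} (h : i ≤ m) :
    eigenvalueInvSqrt a m ≤ eigenvalueInvSqrt a i := by
  have h1 : (0 : ℝ) ≤ i := i.cast_nonneg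
  have h2 : (i : ℝ) ≤ m := Nat.cast_le.2 h
  exact inv_anti₀ (Real.sqrt_pos.2 (by linarith)) (Real.sqrt_le_sqrt (by linarith))

theorem eigenvalueInvSqrt_le_schurWeight (ha : -1 < a) (m : ℕ) :
    eigenvalueInvSqrt a m ≤ schurWeight a m := by
  have h1 : (0 : ℝ) ≤ m := m.cast_nonneg
  exact inv_anti₀ (Real.sqrt_pos.2 (by linarith)) (Real.sqrt_le_sqrt (by linarith))

theorem laguerreNorm_succ_order (ha : -1 < a) (m : ℕ) :
    laguerreNorm (a + 1) m = schurWeight a m * laguerreNorm a m := by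
  have h1 : 0 < (m : ℝ) + a + 1 := by have : (0 : ℝ) ≤ m := m.cast_nonneg; linarith
  have h2 := laguerreNorm_pos (a := a + 1) (by linarith) m
  have h3 := laguerreNorm_pos ha m
  have h4 := schurWeight_pos ha m
  rw [← sq_eq_sq₀ h2.le (by positivity), mul_pow, laguerreNorm_succ_order_sq ha, schurWeight,
    inv_pow, Real.sq_sqrt h1.le]
  field_simp

theorem schurBound_hardy_laguerre (ha : -1 < a) :
    SchurBound (schurWeight a) (fun i m => if i ≤ m then
      laguerreNorm (a + 1) m / laguerreNorm a i * schurWeight a m else 0) (3 / (a + 1)) := by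
  have h1 : ∀ m, laguerreNorm a m ≠ 0 := fun m => (laguerreNorm_pos ha m).ne'
  have h2 : ∀ m, laguerreNorm (a + 1) m ≠ 0 := fun m => (laguerreNorm_pos (by linarith) m).ne'
  have h := schurBound_hardy (c := a + 1) (b := fun m => (laguerreNorm a m)⁻¹)
    (σ := fun m => (laguerreNorm (a + 1) m)⁻¹) (by linarith)
    (fun m => inv_pos.2 (laguerreNorm_pos ha m))
    (fun m => inv_pos.2 (laguerreNorm_pos (by linarith) m)) ?_ fun m => ?_
  · have e1 : schurWeight a = fun m => (laguerreNorm a m)⁻¹ / (laguerreNorm (a + 1) m)⁻¹ := by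
      funext m
      have := h1 m
      rw [laguerreNorm_succ_order ha, inv_div_inv]
      field_simp
    convert h using 4 with i m
    have := h1 m
    have := h2 m
    have := h1 i
    rw [congrFun e1 m]
    field_simp
  · have := h1 0
    have := h2 0
    rw [inv_pow, inv_pow, laguerreNorm_succ_order_sq ha 0]
    have : ((0 : ℕ) : ℝ) + a + 1 ≠ 0 := by push_cast; linarith
    push_cast at this ⊢
    rw [zero_add] at this ⊢
    field_simp
  · have e1 := laguerreNorm_succ_order_sq ha (m + 1)
    have e2 := laguerreNorm_succ_sq ha m
    have i1 := h1 (m + 1)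
    have i2 := h2 m
    have i3 := h2 (m + 1)
    have h5 : ((m + 1 : ℕ) : ℝ) + a + 1 ≠ 0 := by
      have : (0 : ℝ) ≤ (m + 1 : ℕ) := Nat.cast_nonneg _
      linarith
    have e3 : (laguerreNorm (a + 1) (m + 1) ^ 2)⁻¹ =
        ((m + 1 : ℕ) + a + 1) * (laguerreNorm a (m + 1) ^ 2)⁻¹ := by
      rw [e1]
      field_simp
    have e4 : (laguerreNorm (a + 1) m ^ 2)⁻¹ = (m + 1) * (laguerreNorm a (m + 1) ^ 2)⁻¹ := by
      rw [e2]
      field_simp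
    rw [inv_pow, inv_pow, inv_pow, e3, e4]
    push_cast
    ring

theorem schurBound_evenStep (ha : -1 / 2 ≤ a) :
    SchurBound (schurWeight a) (fun i m => |evenStep i m| * eigenvalueInvSqrt a m) 2 := by
  have ha' : -1 < a := by linarith
  have hw := fun i => (schurWeight_pos ha' i).le
  suffices h : SchurBound (schurWeight a) (fun i m => if i + 1 = m then (1 : ℝ) else 0) 2 by
    refine h.mono hw fun i m => ?_
    simp only [evenStep]
    split_ifs with him
    · have hm : (0 : ℝ) ≤ m := m.cast_nonneg
      have h1 : Real.sqrt (4 * m) = 2 * Real.sqrt m := by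
        rw [Real.sqrt_mul (by norm_num), show (4 : ℝ) = 2 ^ 2 by norm_num,
          Real.sqrt_sq (by norm_num)]
      rw [neg_mul, abs_neg, abs_of_nonneg (by positivity), ← h1, eigenvalueInvSqrt,
        ← div_eq_mul_inv]
      exact div_le_one_of_le₀ (Real.sqrt_le_sqrt (by linarith)) (Real.sqrt_nonneg _)
    · simp
  constructor
  · intro i s
    simp only [ite_mul, one_mul, zero_mul, Finset.sum_ite_eq]
    have h1 : schurWeight a (i + 1) ≤ schurWeight a i := by
      have : (0 : ℝ) ≤ i := i.cast_nonneg
      exact inv_anti₀ (Real.sqrt_pos.2 (by linarith))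
        (Real.sqrt_le_sqrt (by push_cast; linarith))
    have := hw i
    split_ifs <;> linarith
  · intro m s
    rcases m with _ | m
    · simpa using hw 0
    · simp only [add_left_inj, ite_mul, one_mul, zero_mul, Finset.sum_ite_eq']
      have h1 : schurWeight a m ≤ 2 * schurWeight a (m + 1) := by
        have hm : (0 : ℝ) ≤ m := m.cast_nonneg
        have h2 : 0 < (m : ℝ) + a + 1 := by linarith
        have h3 : 0 < ((m + 1 : ℕ) : ℝ) + a + 1 := by push_cast; linarith
        have h4 : Real.sqrt ((m + 1 : ℕ) + a + 1) ≤ 2 * Real.sqrt (m + a + 1) := by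
          rw [Real.sqrt_le_left (by positivity), mul_pow, Real.sq_sqrt h2.le]
          push_cast
          linarith
        have h5 := Real.sqrt_pos.2 h2
        have h6 := Real.sqrt_pos.2 h3
        rw [schurWeight, schurWeight, ← div_eq_mul_inv, inv_eq_one_div,
          div_le_div_iff₀ h5 h6]
        linarith
      have := hw (m + 1)
      split_ifs <;> linarith

theorem schurBound_oddStep (ha : -1 / 2 ≤ a) :
    ∃ C, 0 ≤ C ∧
      SchurBound (schurWeight a) (fun i m => |oddStep a i m| * eigenvalueInvSqrt a m) C := by
  have ha' : -1 < a := by linarith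
  have hw := fun i => (schurWeight_pos ha' i).le
  have hr := eigenvalueInvSqrt_nonneg a
  refine ⟨2 * 1 + (2 * a + 1) * (3 / (a + 1)), ?_,
    (((SchurBound.one hw).const_mul two_pos.le).add
      ((schurBound_hardy_laguerre ha').const_mul (c := 2 * a + 1) (by linarith))).mono hw
      fun i m => ?_⟩
  · have : 0 < a + 1 := by linarith
    have : 0 ≤ 2 * a + 1 := by linarith
    positivity
  have hN := laguerreNorm_pos (a := a + 1) (by linarith) m
  have hN' := laguerreNorm_pos ha' i
  have h0 : 0 ≤ (2 * a + 1) * (laguerreNorm (a + 1) m / laguerreNorm a i * schurWeight a m) := by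
    have := hw m
    have : 0 ≤ 2 * a + 1 := by linarith
    positivity
  rcases lt_trichotomy i m with him | rfl | him
  · rw [if_neg him.ne, if_pos him.le, oddStep, if_neg him.ne, if_pos him, neg_mul, abs_neg,
      abs_of_nonneg (mul_nonneg (by linarith) (by positivity)), mul_assoc, mul_zero, zero_add]
    refine mul_le_mul_of_nonneg_left (mul_le_mul_of_nonneg_left
      (eigenvalueInvSqrt_le_schurWeight ha' m) (by positivity)) (by linarith)
  · rw [if_pos rfl, if_pos le_rfl, oddStep, if_pos rfl, laguerreNorm_succ_order ha']
    rw [laguerreNorm_succ_order ha'] at h0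
    refine le_trans ?_ (le_add_of_nonneg_right h0)
    have hi : (0 : ℝ) ≤ i := i.cast_nonneg
    have h1 : 0 < (i : ℝ) + a + 1 := by linarith
    have h2 : 0 < 4 * (i : ℝ) + 2 * a + 2 := by linarith
    rw [mul_div_cancel_right₀ _ hN'.ne', schurWeight, eigenvalueInvSqrt,
      abs_of_nonneg (by positivity), mul_assoc, ← mul_inv, ← Real.sqrt_mul h1.le,
      ← div_eq_mul_inv, div_le_iff₀ (by positivity), mul_one]
    refine le_of_sq_le_sq ?_ (by positivity)
    rw [mul_pow, Real.sq_sqrt (by positivity)]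
    have h3 : (i : ℝ) + 1 / 2 ≤ i + a + 1 := by linarith
    have h4 : 2 * (i : ℝ) + 1 ≤ 4 * i + 2 * a + 2 := by linarith
    nlinarith [mul_le_mul h3 h4 (by positivity) h1.le]
  · rw [if_neg him.ne', if_neg him.not_ge, oddStep, if_neg him.ne', if_neg him.not_gt]
    simp

theorem schurBound_stepMatrix (ha : -1 / 2 ≤ a) (p : ℕ) :
    ∃ C, 0 ≤ C ∧
      SchurBound (schurWeight a) (fun i m => |stepMatrix a p i m| * eigenvalueInvSqrt a m) C := by
  simp only [stepMatrix]
  split_ifs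
  · exact ⟨2, two_pos.le, schurBound_evenStep ha⟩
  · exact schurBound_oddStep ha

/-- The matrix of `δ^p 𝓛^{-p/2}` in one dimension passes the Schur test. As the matrices are
triangular, each factor `𝓛^{-1/2}` may be moved to the left past the others at the cost of an
inequality. -/
theorem schurBound_deltaMatrix (ha : -1 / 2 ≤ a) (p : ℕ) :
    ∃ C, 0 ≤ C ∧ SchurBound (schurWeight a)
      (fun i m => |deltaMatrix a p i m| * eigenvalueInvSqrt a m ^ p) C := by
  have ha' : -1 < a := by linarith
  have hw := fun i => (schurWeight_pos ha' i).le
  have hr := eigenvalueInvSqrt_nonneg a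
  induction p with
  | zero =>
    refine ⟨1, one_pos.le, (SchurBound.one hw).mono hw fun i m => ?_⟩
    simp only [deltaMatrix, pow_zero, mul_one]
    split_ifs <;> simp
  | succ p ih =>
    obtain ⟨C, hC, h⟩ := ih
    obtain ⟨C', hC', h'⟩ := schurBound_stepMatrix ha p
    refine ⟨C' * C, mul_nonneg hC' hC, (h'.comp h
      (fun i m => mul_nonneg (abs_nonneg _) (hr m))
      (fun i m => mul_nonneg (abs_nonneg _) (pow_nonneg (hr m) p)) hw hC' hC
      fun m => Finset.range (m + 1)).mono hw fun i m => ?_⟩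
    rw [deltaMatrix]
    refine (mul_le_mul_of_nonneg_right (Finset.abs_sum_le_sum_abs _ _)
      (pow_nonneg (hr m) _)).trans ?_
    rw [Finset.sum_mul]
    refine Finset.sum_le_sum fun q hq => ?_
    have h1 := eigenvalueInvSqrt_anti ha' (Finset.mem_range_succ_iff.1 hq)
    rw [abs_mul, pow_succ']
    calc _ = |stepMatrix a p i q| * eigenvalueInvSqrt a m *
          (|deltaMatrix a p q m| * eigenvalueInvSqrt a m ^ p) := by ring
      _ ≤ _ := mul_le_mul_of_nonneg_right (mul_le_mul_of_nonneg_left h1 (abs_nonneg _))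
          (mul_nonneg (abs_nonneg _) (pow_nonneg (hr m) p))

end

/-! ### Orthonormality of the Laguerre functions -/

theorem gamma_add_nat_eq_ascPochhammer_mul {z : ℝ} (hz : 0 < z) (j : ℕ) :
    Real.Gamma (z + j) = (ascPochhammer ℝ j).eval z * Real.Gamma z := by
  induction j with
  | zero => simp
  | succ j ih =>
    rw [ascPochhammer_succ_eval, Nat.cast_succ, ← add_assoc,
      Real.Gamma_add_one (by positivity), ih]
    ring

/-- The alternating binomial sum of a polynomial of degree `j ≤ m` is its `m`-th finite
difference. -/
theorem sum_neg_one_pow_mul_choose_mul_ascPochhammer (z : ℝ) {m j : ℕ} (h : j ≤ m) :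
    ∑ i ∈ Finset.range (m + 1), (-1) ^ i * (m.choose i : ℝ) * (ascPochhammer ℝ j).eval (z + i) =
      if j = m then (-1) ^ m * (m.factorial : ℝ) else 0 := by
  have h1 := fwdDiff_iter_eq_sum_shift (1 : ℝ) (ascPochhammer ℝ j).eval m z
  have h2 : ∑ i ∈ Finset.range (m + 1),
      (-1) ^ i * (m.choose i : ℝ) * (ascPochhammer ℝ j).eval (z + i) =
      (-1) ^ m * (fwdDiff (1 : ℝ))^[m] (ascPochhammer ℝ j).eval z := by
    rw [h1, Finset.mul_sum]
    refine Finset.sum_congr rfl fun i hi => ?_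
    have hi := Finset.mem_range_succ_iff.1 hi
    have h3 : (-1 : ℝ) ^ i = (-1) ^ m * (-1) ^ (m - i) := by
      have h4 : (-1 : ℝ) ^ m = (-1) ^ i * (-1) ^ (m - i) := by rw [← pow_add, Nat.add_sub_cancel' hi]
      rw [h4, mul_assoc, ← mul_pow]
      simp
    rw [zsmul_eq_mul, h3]
    push_cast
    simp only [nsmul_eq_mul, mul_one]
    ring
  rw [h2]
  have hdeg : (ascPochhammer ℝ j).natDegree = j := ascPochhammer_natDegree ℝ j
  split_ifs with hjm
  · subst hjm
    have h3 := Polynomial.fwdDiff_iter_degree_eq_factorial (ascPochhammer ℝ j)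
    rw [hdeg, (monic_ascPochhammer ℝ j).leadingCoeff] at h3
    rw [h3]
    simp
  · have h3 := Polynomial.fwdDiff_iter_eq_zero_of_degree_lt (P := ascPochhammer ℝ j) (n := m)
      (by rw [hdeg]; omega)
    rw [h3]
    simp

section

variable {a : ℝ}

theorem laguerre_moment_integrand (a : ℝ) (i : ℕ) {x : ℝ} (hx : 0 < x) :
    (x ^ (a + 1 / 2) * Real.exp (-x ^ 2 / 2)) ^ 2 * (x ^ 2) ^ i =
      x ^ (2 * i + 2 * a + 1) * Real.exp (-x ^ (2 : ℝ)) := by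
  have e1 : (x ^ (a + 1 / 2)) ^ 2 = x ^ (2 * a + 1) := by
    rw [← Real.rpow_natCast, ← Real.rpow_mul hx.le]
    congr 1
    push_cast
    ring
  have e3 : Real.exp (-x ^ 2 / 2) ^ 2 = Real.exp (-x ^ (2 : ℝ)) := by
    rw [← Real.exp_nat_mul, Real.rpow_two]
    congr 1
    push_cast
    ring
  have e2 : x ^ (2 * i + 2 * a + 1) = x ^ (2 * a + 1) * (x ^ 2) ^ i := by
    rw [← pow_mul, ← Real.rpow_natCast, ← Real.rpow_add hx]
    congr 1
    push_cast
    ring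
  rw [mul_pow, e1, e3, e2]
  ring

theorem integral_laguerre_moment (ha : -1 < a) (i : ℕ) :
    ∫ x in Set.Ioi (0 : ℝ), (x ^ (a + 1 / 2) * Real.exp (-x ^ 2 / 2)) ^ 2 * (x ^ 2) ^ i =
      Real.Gamma (i + a + 1) / 2 := by
  rw [setIntegral_congr_fun measurableSet_Ioi fun x hx => laguerre_moment_integrand a i hx,
    integral_rpow_mul_exp_neg_rpow two_pos
      (by have : (0 : ℝ) ≤ i := i.cast_nonneg; linarith)]
  rw [show (2 * (i : ℝ) + 2 * a + 1 + 1) / 2 = i + a + 1 by ring]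
  ring

theorem integrableOn_laguerre_moment (ha : -1 < a) (i : ℕ) :
    IntegrableOn (fun x : ℝ => (x ^ (a + 1 / 2) * Real.exp (-x ^ 2 / 2)) ^ 2 * (x ^ 2) ^ i)
      (Set.Ioi 0) := by
  refine IntegrableOn.congr_fun (f := fun x : ℝ => x ^ (2 * i + 2 * a + 1) * Real.exp (-1 * x ^ 2))
    (integrableOn_rpow_mul_exp_neg_mul_sq one_pos
      (by have : (0 : ℝ) ≤ i := i.cast_nonneg; linarith)) (fun x hx => ?_) measurableSet_Ioi
  rw [laguerre_moment_integrand a i hx, Real.rpow_two]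
  simp only [neg_one_mul]

theorem integrableOn_laguerrePoly_mul_pow (ha : -1 < a) (m j : ℕ) :
    IntegrableOn (fun x : ℝ => (x ^ (a + 1 / 2) * Real.exp (-x ^ 2 / 2)) ^ 2 *
      (laguerrePoly a m (x ^ 2) * (x ^ 2) ^ j)) (Set.Ioi 0) := by
  have h : (fun x : ℝ => (x ^ (a + 1 / 2) * Real.exp (-x ^ 2 / 2)) ^ 2 *
      (laguerrePoly a m (x ^ 2) * (x ^ 2) ^ j)) = fun x => ∑ i ∈ Finset.range (m + 1),
      laguerreCoeff a m i * (-1) ^ i *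
        ((x ^ (a + 1 / 2) * Real.exp (-x ^ 2 / 2)) ^ 2 * (x ^ 2) ^ (i + j)) := by
    funext x
    rw [laguerrePoly_eq_sum _ (Nat.lt_succ_self m), Finset.sum_mul, Finset.mul_sum]
    refine Finset.sum_congr rfl fun i _ => ?_
    rw [neg_pow (x ^ 2), pow_add]
    ring
  rw [h]
  exact integrable_finsetSum _ fun i _ => (integrableOn_laguerre_moment ha _).const_mul _

theorem integral_laguerrePoly_mul_pow (ha : -1 < a) {m j : ℕ} (hj : j ≤ m) :
    ∫ x in Set.Ioi (0 : ℝ), (x ^ (a + 1 / 2) * Real.exp (-x ^ 2 / 2)) ^ 2 *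
      (laguerrePoly a m (x ^ 2) * (x ^ 2) ^ j) =
      if j = m then (-1) ^ m * Real.Gamma (m + a + 1) / 2 else 0 := by
  have h : ∀ x : ℝ, (x ^ (a + 1 / 2) * Real.exp (-x ^ 2 / 2)) ^ 2 *
      (laguerrePoly a m (x ^ 2) * (x ^ 2) ^ j) = ∑ i ∈ Finset.range (m + 1),
      laguerreCoeff a m i * (-1) ^ i *
        ((x ^ (a + 1 / 2) * Real.exp (-x ^ 2 / 2)) ^ 2 * (x ^ 2) ^ (i + j)) := by
    intro x
    rw [laguerrePoly_eq_sum _ (Nat.lt_succ_self m), Finset.sum_mul, Finset.mul_sum]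
    refine Finset.sum_congr rfl fun i _ => ?_
    rw [neg_pow (x ^ 2), pow_add]
    ring
  simp only [h]
  rw [integral_finsetSum _ fun i _ => (integrableOn_laguerre_moment ha _).const_mul _]
  have h1 : ∀ i ∈ Finset.range (m + 1), (∫ x in Set.Ioi (0 : ℝ), laguerreCoeff a m i * (-1) ^ i *
        ((x ^ (a + 1 / 2) * Real.exp (-x ^ 2 / 2)) ^ 2 * (x ^ 2) ^ (i + j))) =
      Real.Gamma (m + a + 1) / (2 * m.factorial) *
        ((-1) ^ i * (m.choose i : ℝ) * (ascPochhammer ℝ j).eval (a + 1 + i)) := by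
    intro i hi
    have hi := Finset.mem_range_succ_iff.1 hi
    have h2 := gamma_add_nat_eq_ascPochhammer_mul (z := a + 1 + i)
      (by have : (0 : ℝ) ≤ i := i.cast_nonneg; linarith) j
    have h3 := (gamma_nat_add_pos ha i).ne'
    rw [show a + 1 + (i : ℝ) + j = ((i + j : ℕ) : ℝ) + a + 1 by push_cast; ring,
      show a + 1 + (i : ℝ) = i + a + 1 by ring] at h2
    rw [integral_const_mul, integral_laguerre_moment ha, h2, laguerreCoeff, if_pos hi,
      Nat.cast_choose ℝ hi, show a + 1 + (i : ℝ) = i + a + 1 by ring]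
    have : (m.factorial : ℝ) ≠ 0 := by positivity
    have : (i.factorial : ℝ) ≠ 0 := by positivity
    have : ((m - i).factorial : ℝ) ≠ 0 := by positivity
    field_simp
  rw [Finset.sum_congr rfl h1, ← Finset.mul_sum,
    sum_neg_one_pow_mul_choose_mul_ascPochhammer _ hj]
  have : (m.factorial : ℝ) ≠ 0 := by positivity
  split_ifs
  · field_simp
  · ring

theorem integral_laguerreFun1_mul_of_le (ha : -1 < a) {m k : ℕ} (hk : k ≤ m) :
    ∫ x in Set.Ioi (0 : ℝ), laguerreFun1 a m x * laguerreFun1 a k x =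
      if m = k then 1 else 0 := by
  have h : ∀ x : ℝ, laguerreFun1 a m x * laguerreFun1 a k x = ∑ j ∈ Finset.range (k + 1),
      laguerreNorm a m * laguerreNorm a k * (laguerreCoeff a k j * (-1) ^ j) *
      ((x ^ (a + 1 / 2) * Real.exp (-x ^ 2 / 2)) ^ 2 *
        (laguerrePoly a m (x ^ 2) * (x ^ 2) ^ j)) := by
    intro x
    have h1 : laguerreFun1 a m x * laguerreFun1 a k x = (laguerreNorm a m * laguerreNorm a k *
        ((x ^ (a + 1 / 2) * Real.exp (-x ^ 2 / 2)) ^ 2 * laguerrePoly a m (x ^ 2))) *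
        laguerrePoly a k (x ^ 2) := by
      rw [laguerreFun1_eq, laguerreFun1_eq]
      ring
    rw [h1, laguerrePoly_eq_sum _ (Nat.lt_succ_self k), Finset.mul_sum]
    refine Finset.sum_congr rfl fun j _ => ?_
    rw [neg_pow (x ^ 2)]
    ring
  simp only [h]
  rw [integral_finsetSum _ fun j _ => (integrableOn_laguerrePoly_mul_pow ha m j).const_mul _]
  have h1 : ∀ j ∈ Finset.range (k + 1), (∫ x in Set.Ioi (0 : ℝ),
      laguerreNorm a m * laguerreNorm a k * (laguerreCoeff a k j * (-1) ^ j) *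
      ((x ^ (a + 1 / 2) * Real.exp (-x ^ 2 / 2)) ^ 2 *
        (laguerrePoly a m (x ^ 2) * (x ^ 2) ^ j))) =
      laguerreNorm a m * laguerreNorm a k * (laguerreCoeff a k j * (-1) ^ j) *
        if j = m then (-1) ^ m * Real.Gamma (m + a + 1) / 2 else 0 := fun j hj => by
    rw [integral_const_mul, integral_laguerrePoly_mul_pow ha
      ((Finset.mem_range_succ_iff.1 hj).trans hk)]
  rw [Finset.sum_congr rfl h1]
  split_ifs with hmk
  · subst hmk
    rw [Finset.sum_eq_single m (fun j _ hj => by rw [if_neg hj, mul_zero]) (by simp), if_pos rfl,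
      ← sq, laguerreNorm_sq ha, Real.Gamma_nat_eq_factorial, laguerreCoeff, if_pos le_rfl]
    have := (gamma_nat_add_pos ha m).ne'
    have : (m.factorial : ℝ) ≠ 0 := by positivity
    have h2 : ((-1 : ℝ) ^ m) * (-1) ^ m = 1 := by rw [← mul_pow]; simp
    simp only [Nat.sub_self, Nat.factorial_zero, Nat.cast_one, mul_one]
    field_simp
    rw [sq, h2]
  · refine Finset.sum_eq_zero fun j hj => ?_
    rw [if_neg (by have := Finset.mem_range_succ_iff.1 hj; omega), mul_zero]

theorem integral_laguerreFun1_mul (ha : -1 < a) (m k : ℕ) :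
    ∫ x in Set.Ioi (0 : ℝ), laguerreFun1 a m x * laguerreFun1 a k x =
      if m = k then 1 else 0 := by
  rcases le_total k m with h | h
  · exact integral_laguerreFun1_mul_of_le ha h
  · simp only [mul_comm (laguerreFun1 a m _), eq_comm (a := m)]
    exact integral_laguerreFun1_mul_of_le ha h

end

theorem orthonormal_laguerreL2 {n : ℕ} {ν : Fin n → ℝ} (hν : ∀ j, -1 / 2 ≤ ν j) :
    Orthonormal ℂ (laguerreL2 hν) := by
  rw [orthonormal_iff_ite]
  intro α β
  rw [L2.inner_def]
  have h1 : ∫ x, inner ℂ (laguerreL2 hν α x) (laguerreL2 hν β x)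
      ∂(volume : Measure (Fin n → ℝ)).restrict (orthant n) =
      ∫ x, ((∏ j, laguerreFun1 (ν j) (α j) (x j) * laguerreFun1 (ν j) (β j) (x j) : ℝ) : ℂ)
        ∂(volume : Measure (Fin n → ℝ)).restrict (orthant n) := by
    refine integral_congr_ae ?_
    filter_upwards [(memLp_laguerreFun hν α).coeFn_toLp, (memLp_laguerreFun hν β).coeFn_toLp]
      with x h1 h2
    rw [laguerreL2, laguerreL2, h1, h2, RCLike.inner_apply, Finset.prod_mul_distrib,
      laguerreFun, laguerreFun, Complex.conj_ofReal, ← Complex.ofReal_mul, mul_comm]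
  rw [h1, integral_complex_ofReal, orthant, volume_pi, Measure.restrict_pi_pi,
    integral_fintype_prod_eq_prod
      (f := fun j x => laguerreFun1 (ν j) (α j) x * laguerreFun1 (ν j) (β j) x)]
  have h2 : ∀ j, -1 < ν j := fun j => by linarith [hν j]
  simp only [fun j => integral_laguerreFun1_mul (h2 j)]
  rw [Fintype.prod_ite_zero]
  simp only [Finset.prod_const_one, funext_iff]
  split_ifs <;> simp

/-! ### Integration by parts against test functions -/

section

variable {n : ℕ}

/-- Test functions: smooth functions with compact support inside the open orthant. -/
structure IsTest (ψ : (Fin n → ℝ) → ℝ) : Prop where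
  contDiff : ContDiff ℝ (⊤ : ℕ∞) ψ
  hasCompactSupport : HasCompactSupport ψ
  tsupport_subset : tsupport ψ ⊆ orthant n

theorem isOpen_orthant : IsOpen (orthant n) :=
  isOpen_set_pi Set.finite_univ fun _ _ => isOpen_Ioi

theorem pos_of_mem_orthant {x : Fin n → ℝ} (hx : x ∈ orthant n) (j : Fin n) : 0 < x j :=
  hx j (Set.mem_univ j)

theorem tsupport_deltaStar_subset (ν : Fin n → ℝ) (j : Fin n) (ψ : (Fin n → ℝ) → ℝ) :
    tsupport (deltaStar ν j ψ) ⊆ tsupport ψ := by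
  refine closure_minimal (fun x hx => ?_) (isClosed_tsupport ψ)
  by_contra h
  refine hx ?_
  rw [deltaStar, fderiv_of_notMem_tsupport ℝ h, image_eq_zero_of_notMem_tsupport h]
  simp

theorem IsTest.deltaStar {ψ : (Fin n → ℝ) → ℝ} (hψ : IsTest ψ) (ν : Fin n → ℝ) (j : Fin n) :
    IsTest (deltaStar ν j ψ) := by
  have hsub := tsupport_deltaStar_subset ν j ψ
  refine ⟨contDiff_iff_contDiffAt.2 fun x => ?_, hψ.hasCompactSupport.mono' ?_,
    hsub.trans hψ.tsupport_subset⟩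
  · by_cases hx : x ∈ tsupport ψ
    · have hxj := (pos_of_mem_orthant (hψ.tsupport_subset hx) j).ne'
      have h1 : ContDiff ℝ (⊤ : ℕ∞) fun x => fderiv ℝ ψ x (Pi.single j 1) :=
        (hψ.contDiff.fderiv_right (m := (⊤ : ℕ∞)) (by exact_mod_cast le_rfl)).clm_apply
          contDiff_const
      have h2 : ContDiffAt ℝ (⊤ : ℕ∞) (fun x : Fin n → ℝ => x j) x :=
        (contDiff_apply ℝ ℝ j).contDiffAt
      exact h1.contDiffAt.neg.add ((h2.sub ((contDiffAt_const.div h2 hxj).mul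
        contDiffAt_const)).mul hψ.contDiff.contDiffAt)
    · have h := notMem_tsupport_iff_eventuallyEq.1 fun h => hx (hsub h)
      exact contDiffAt_const.congr_of_eventuallyEq h
  · exact (subset_tsupport _).trans hsub

theorem IsTest.iterate_deltaStar {ψ : (Fin n → ℝ) → ℝ} (hψ : IsTest ψ) (ν : Fin n → ℝ)
    (j : Fin n) (m : ℕ) : IsTest ((Laguerre.deltaStar ν j)^[m] ψ) := by
  induction m with
  | zero => exact hψ
  | succ m ih =>
    rw [Function.iterate_succ_apply']
    exact ih.deltaStar ν j

theorem IsTest.foldr_deltaStar {ψ : (Fin n → ℝ) → ℝ} (hψ : IsTest ψ) (ν : Fin n → ℝ)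
    (k : Fin n → ℕ) (l : List (Fin n)) :
    IsTest (l.foldr (fun j F => (Laguerre.deltaStar ν j)^[k j] F) ψ) := by
  induction l with
  | nil => exact hψ
  | cons j l ih => exact ih.iterate_deltaStar ν j (k j)

theorem integrable_mul_of_continuousOn_orthant {F φ : (Fin n → ℝ) → ℝ}
    (hF : ContinuousOn F (orthant n)) (hφ : Continuous φ) (hc : HasCompactSupport φ)
    (hs : tsupport φ ⊆ orthant n) : Integrable (fun x => F x * φ x) := by
  refine Continuous.integrable_of_hasCompactSupport (continuous_iff_continuousAt.2 fun x => ?_)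
    (hc.mul_left (f := F))
  by_cases hx : x ∈ tsupport φ
  · exact (hF.continuousAt (isOpen_orthant.mem_nhds (hs hx))).mul hφ.continuousAt
  · refine (continuousAt_const (y := (0 : ℝ))).congr ?_
    filter_upwards [notMem_tsupport_iff_eventuallyEq.1 hx] with y hy
    simp [hy]

theorem setIntegral_orthant_mul_of_tsupport_subset {F φ : (Fin n → ℝ) → ℝ}
    (hs : tsupport φ ⊆ orthant n) : ∫ x in orthant n, F x * φ x = ∫ x, F x * φ x :=
  setIntegral_eq_integral_of_forall_compl_eq_zero fun x hx => by
    rw [image_eq_zero_of_notMem_tsupport fun h => hx (hs h), mul_zero]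

theorem IsDelta.continuousOn {a : ℝ} {F G : ℝ → ℝ} (h : IsDelta a F G) :
    ContinuousOn F (Set.Ioi 0) := fun x hx => (h x hx).continuousAt.continuousWithinAt

theorem continuousOn_prod_orthant {g : Fin n → ℝ → ℝ}
    (hg : ∀ i, ContinuousOn (g i) (Set.Ioi 0)) :
    ContinuousOn (fun x : Fin n → ℝ => ∏ i, g i (x i)) (orthant n) :=
  continuousOn_finsetProd _ fun i _ =>
    (hg i).comp (continuous_apply i).continuousOn fun _ hx => pos_of_mem_orthant hx i

variable {ν : Fin n → ℝ} {g : Fin n → ℕ → ℝ → ℝ}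

/-- Integration by parts in one coordinate for a product function `∏ g_i`, where `g i p` is the
`p`-th iterate of `δ` on a function of one variable. -/
theorem integral_prod_mul_deltaStar (hg : ∀ i p, IsDelta (ν i) (g i p) (g i (p + 1)))
    (p : Fin n → ℕ) (j : Fin n) {ψ : (Fin n → ℝ) → ℝ} (hψ : IsTest ψ) :
    ∫ x in orthant n, (∏ i, g i (p i) (x i)) * deltaStar ν j ψ x =
      ∫ x in orthant n, (∏ i, g i ((p + Pi.single j 1 : Fin n → ℕ) i) (x i)) * ψ x := by
  rw [setIntegral_orthant_mul_of_tsupport_subset (hψ.deltaStar ν j).tsupport_subset,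
    setIntegral_orthant_mul_of_tsupport_subset hψ.tsupport_subset]
  set c : (Fin n → ℝ) → ℝ := fun x => x j - 1 / x j * (ν j + 1 / 2)
  set G : (Fin n → ℕ) → (Fin n → ℝ) → ℝ := fun p x => ∏ i, g i (p i) (x i)
  set G' : (Fin n → ℝ) → ℝ := fun x => G (p + Pi.single j 1) x - c x * G p x
  have hc : ContinuousOn c (orthant n) := by
    have h1 : ContinuousOn (fun x : Fin n → ℝ => x j) (orthant n) :=
      (continuous_apply j).continuousOn
    exact h1.sub ((continuousOn_const.div h1 fun x hx => (pos_of_mem_orthant hx j).ne').mul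
      continuousOn_const)
  have hG : ∀ p, ContinuousOn (G p) (orthant n) := fun p =>
    continuousOn_prod_orthant fun i => (hg i (p i)).continuousOn
  have hG' : ContinuousOn G' (orthant n) := (hG _).sub (hc.mul (hG p))
  have hder : ∀ x ∈ tsupport ψ, HasLineDerivAt ℝ (G p) (G' x) x (Pi.single j 1) := by
    intro x hx
    have hxj := pos_of_mem_orthant (hψ.tsupport_subset hx) j
    have e1 : (fun t : ℝ => G p (x + t • Pi.single j 1)) = fun t =>
        g j (p j) (x j + t) * ∏ i ∈ Finset.univ.erase j, g i (p i) (x i) := by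
      funext t
      simp only [G]
      rw [← Finset.mul_prod_erase _ _ (Finset.mem_univ j)]
      congr 1
      · simp
      · refine Finset.prod_congr rfl fun i hi => ?_
        simp [Finset.ne_of_mem_erase hi]
    have e2 : G (p + Pi.single j 1) x =
        g j (p j + 1) (x j) * ∏ i ∈ Finset.univ.erase j, g i (p i) (x i) := by
      simp only [G]
      rw [← Finset.mul_prod_erase _ _ (Finset.mem_univ j)]
      congr 1
      · simp
      · refine Finset.prod_congr rfl fun i hi => ?_
        simp [Finset.ne_of_mem_erase hi]
    have e3 : G p x = g j (p j) (x j) * ∏ i ∈ Finset.univ.erase j, g i (p i) (x i) :=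
      (Finset.mul_prod_erase _ _ (Finset.mem_univ j)).symm
    rw [HasLineDerivAt, e1]
    have h1 := hg j (p j) (x j) hxj
    rw [← add_zero (x j)] at h1
    refine ((HasDerivAt.comp_const_add (x j) 0 h1).mul_const _).congr_deriv ?_
    simp only [G', e2, e3, c, add_zero]
    ring
  have hdψ : Continuous fun x => fderiv ℝ ψ x (Pi.single j 1) :=
    (hψ.contDiff.continuous_fderiv (by simp)).clm_apply continuous_const
  have hdc : HasCompactSupport fun x => fderiv ℝ ψ x (Pi.single j 1) :=
    hψ.hasCompactSupport.fderiv_apply ℝ _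
  have hds : tsupport (fun x => fderiv ℝ ψ x (Pi.single j 1)) ⊆ orthant n :=
    (tsupport_fderiv_apply_subset ℝ _).trans hψ.tsupport_subset
  have hψc := hψ.contDiff.continuous
  have i1 := integrable_mul_of_continuousOn_orthant hG' hψc hψ.hasCompactSupport
    hψ.tsupport_subset
  have i2 := integrable_mul_of_continuousOn_orthant (hG p) hdψ hdc hds
  have i3 := integrable_mul_of_continuousOn_orthant (hG p) hψc hψ.hasCompactSupport
    hψ.tsupport_subset
  have i4 : Integrable fun x => G p x * c x * ψ x :=
    integrable_mul_of_continuousOn_orthant ((hG p).mul hc) hψc hψ.hasCompactSupport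
      hψ.tsupport_subset
  have key := integral_bilinear_hasLineDerivAt_right_eq_neg_left_of_integrable
    (μ := (volume : Measure (Fin n → ℝ))) (B := ContinuousLinearMap.mul ℝ ℝ)
    (f := G p) (f' := G') (g := ψ) (g' := fun x => fderiv ℝ ψ x (Pi.single j 1)) i1 i2 i3 hder
    fun x _ => (hψ.contDiff.differentiable (by simp) x).hasFDerivAt.hasLineDerivAt _
  simp only [ContinuousLinearMap.mul_apply'] at key
  calc ∫ x, G p x * deltaStar ν j ψ x
      = ∫ x, (G p x * c x * ψ x - G p x * fderiv ℝ ψ x (Pi.single j 1)) := by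
        refine integral_congr_ae (Filter.Eventually.of_forall fun x => ?_)
        simp only [deltaStar, c]
        ring
    _ = ∫ x, (G p x * c x * ψ x + G' x * ψ x) := by
        rw [integral_sub i4 i2, key, sub_neg_eq_add, ← integral_add i4 i1]
    _ = ∫ x, G (p + Pi.single j 1) x * ψ x := by
        refine integral_congr_ae (Filter.Eventually.of_forall fun x => ?_)
        simp only [G']
        ring

theorem integral_prod_mul_iterate_deltaStar (hg : ∀ i p, IsDelta (ν i) (g i p) (g i (p + 1)))
    (j : Fin n) {ψ : (Fin n → ℝ) → ℝ} (hψ : IsTest ψ) (m : ℕ) (p : Fin n → ℕ) :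
    ∫ x in orthant n, (∏ i, g i (p i) (x i)) * (deltaStar ν j)^[m] ψ x =
      ∫ x in orthant n, (∏ i, g i ((p + Pi.single j m : Fin n → ℕ) i) (x i)) * ψ x := by
  induction m generalizing p with
  | zero => simp
  | succ m ih =>
    rw [Function.iterate_succ_apply',
      integral_prod_mul_deltaStar hg p j (hψ.iterate_deltaStar ν j m), ih, add_assoc,
      ← Pi.single_add, add_comm 1 m]

theorem integral_prod_mul_foldr_deltaStar (hg : ∀ i p, IsDelta (ν i) (g i p) (g i (p + 1)))
    (k : Fin n → ℕ) {ψ : (Fin n → ℝ) → ℝ} (hψ : IsTest ψ) (l : List (Fin n)) (p : Fin n → ℕ) :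
    ∫ x in orthant n, (∏ i, g i (p i) (x i)) *
        l.foldr (fun j F => (deltaStar ν j)^[k j] F) ψ x =
      ∫ x in orthant n,
        (∏ i, g i ((p + (l.map fun j => Pi.single j (k j)).sum : Fin n → ℕ) i) (x i)) * ψ x := by
  induction l generalizing p with
  | nil => simp
  | cons j l ih =>
    rw [List.foldr_cons, integral_prod_mul_iterate_deltaStar hg j (hψ.foldr_deltaStar ν k l), ih,
      List.map_cons, List.sum_cons, add_assoc]

/-- Integration by parts for the full operator `δ^k`. -/
theorem integral_prod_mul_deltaStarPow (hg : ∀ i p, IsDelta (ν i) (g i p) (g i (p + 1)))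
    (k : Fin n → ℕ) {ψ : (Fin n → ℝ) → ℝ} (hψ : IsTest ψ) :
    ∫ x in orthant n, (∏ i, g i 0 (x i)) * deltaStarPow ν k ψ x =
      ∫ x in orthant n, (∏ i, g i (k i) (x i)) * ψ x := by
  have h := integral_prod_mul_foldr_deltaStar hg k hψ (List.finRange n) 0
  rw [← Fin.sum_univ_def, Finset.univ_sum_single] at h
  simpa [deltaStarPow] using h

end

/-! ### Riesz transforms -/

section

variable {n : ℕ}

theorem eigenvalue_eq_sum (ν : Fin n → ℝ) (α : Fin n → ℕ) :
    eigenvalue ν α = ∑ j, (4 * (α j : ℝ) + 2 * ν j + 2) := by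
  simp only [eigenvalue, Finset.sum_add_distrib, ← Finset.mul_sum, Finset.sum_const,
    Finset.card_univ, Fintype.card_fin, nsmul_eq_mul]
  ring

theorem one_le_eigenvalue_summand {a : ℝ} (ha : -1 / 2 ≤ a) (m : ℕ) :
    1 ≤ 4 * (m : ℝ) + 2 * a + 2 := by
  have : (0 : ℝ) ≤ m := m.cast_nonneg
  linarith

theorem eigenvalue_summand_le {ν : Fin n → ℝ} (hν : ∀ j, -1 / 2 ≤ ν j) (α : Fin n → ℕ)
    (j : Fin n) : 4 * (α j : ℝ) + 2 * ν j + 2 ≤ eigenvalue ν α := by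
  rw [eigenvalue_eq_sum]
  exact Finset.single_le_sum (f := fun j => 4 * (α j : ℝ) + 2 * ν j + 2)
    (fun i _ => zero_le_one.trans (one_le_eigenvalue_summand (hν i) (α i))) (Finset.mem_univ j)

theorem one_le_eigenvalue (hn : 1 ≤ n) {ν : Fin n → ℝ} (hν : ∀ j, -1 / 2 ≤ ν j)
    (α : Fin n → ℕ) : 1 ≤ eigenvalue ν α :=
  (one_le_eigenvalue_summand (hν ⟨0, hn⟩) _).trans (eigenvalue_summand_le hν α _)

/-- The eigenvalues dominate those of each one-dimensional factor, so the negative power of order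
`|k| / 2` splits over the coordinates. -/
theorem eigenvalue_rpow_le (hn : 1 ≤ n) {ν : Fin n → ℝ} (hν : ∀ j, -1 / 2 ≤ ν j)
    (k α : Fin n → ℕ) : eigenvalue ν α ^ (-((∑ j, (k j : ℝ)) / 2)) ≤
      ∏ j, eigenvalueInvSqrt (ν j) (α j) ^ k j := by
  have h0 : 0 < eigenvalue ν α := one_pos.trans_le (one_le_eigenvalue hn hν α)
  rw [Finset.sum_div, ← Finset.sum_neg_distrib, Real.rpow_sum_of_pos h0]
  refine Finset.prod_le_prod (fun j _ => (Real.rpow_pos_of_pos h0 _).le) fun j _ => ?_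
  have h1 : 0 < 4 * (α j : ℝ) + 2 * ν j + 2 :=
    one_pos.trans_le (one_le_eigenvalue_summand (hν j) _)
  refine (Real.rpow_le_rpow_of_nonpos h1 (eigenvalue_summand_le hν α j)
    (by have : (0 : ℝ) ≤ k j := (k j).cast_nonneg; linarith)).trans (le_of_eq ?_)
  rw [eigenvalueInvSqrt, Real.sqrt_eq_rpow, ← Real.rpow_neg h1.le, ← Real.rpow_natCast,
    ← Real.rpow_mul h1.le]
  congr 1
  ring

/-- The orders of the Laguerre functions in which `δ^k φ_α` expands. -/
def shiftedOrder (ν : Fin n → ℝ) (k : Fin n → ℕ) (j : Fin n) : ℝ := ν j + (k j % 2 : ℕ)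

theorem neg_half_le_shiftedOrder {ν : Fin n → ℝ} (hν : ∀ j, -1 / 2 ≤ ν j) (k : Fin n → ℕ)
    (j : Fin n) : -1 / 2 ≤ shiftedOrder ν k j :=
  (hν j).trans (le_add_of_nonneg_right (Nat.cast_nonneg _))

/-- The coordinates of `δ^k 𝓛^{-|k|/2} φ_α` in the Laguerre functions of shifted order. -/
def rieszMatrix (ν : Fin n → ℝ) (k β α : Fin n → ℕ) : ℝ :=
  eigenvalue ν α ^ (-((∑ j, (k j : ℝ)) / 2)) * ∏ j, deltaMatrix (ν j) (k j) (β j) (α j)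

/-- The element `δ^k 𝓛^{-|k|/2} φ_α` of `L²`. -/
def rieszImage {ν : Fin n → ℝ} (hν : ∀ j, -1 / 2 ≤ ν j) (k α : Fin n → ℕ) : L2 n :=
  ∑ β ∈ Fintype.piFinset fun j => Finset.range (α j + 1),
    (rieszMatrix ν k β α : ℂ) • laguerreL2 (neg_half_le_shiftedOrder hν k) β

theorem prod_deltaFun_eq_sum (ν : Fin n → ℝ) (k α : Fin n → ℕ) (x : Fin n → ℝ) :
    ∏ j, deltaFun (ν j) (α j) (k j) (x j) =
      ∑ β ∈ Fintype.piFinset fun j => Finset.range (α j + 1),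
        (∏ j, deltaMatrix (ν j) (k j) (β j) (α j)) * laguerreFun (shiftedOrder ν k) β x := by
  simp only [deltaFun, Finset.prod_univ_sum, Finset.prod_mul_distrib]
  rfl

theorem exists_norm_sum_rieszImage_le (hn : 1 ≤ n) {ν : Fin n → ℝ} (hν : ∀ j, -1 / 2 ≤ ν j)
    (k : Fin n → ℕ) : ∃ C, 0 ≤ C ∧ ∀ (s : Finset (Fin n → ℕ)) (a : (Fin n → ℕ) → ℂ),
      ‖∑ α ∈ s, a α • rieszImage hν k α‖ ^ 2 ≤ C ^ 2 * ∑ α ∈ s, ‖a α‖ ^ 2 := by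
  choose C hC h using fun j => schurBound_deltaMatrix (hν j) (k j)
  have hν' : ∀ j, -1 < ν j := fun j => by linarith [hν j]
  have hr := eigenvalueInvSqrt_nonneg
  refine ⟨∏ j, C j, Finset.prod_nonneg fun j _ => hC j, fun s a => ?_⟩
  refine norm_sum_smul_sq_le_of_schurBound
    (orthonormal_laguerreL2 (neg_half_le_shiftedOrder hν k))
    (SchurBound.pi h (fun j i m => mul_nonneg (abs_nonneg _) (pow_nonneg (hr _ _) _))
      fun j i => (schurWeight_pos (hν' j) i).le)
    (fun i => Finset.prod_pos fun j _ => schurWeight_pos (hν' j) _)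
    (Finset.prod_nonneg fun j _ => hC j)
    (A := fun β α => (rieszMatrix ν k β α : ℂ)) (fun β α => ?_) (fun α β hβ => ?_)
    (fun α => rfl) s a
  · rw [Complex.norm_real, Real.norm_eq_abs, rieszMatrix, abs_mul, Finset.abs_prod,
      Finset.prod_mul_distrib, mul_comm,
      abs_of_nonneg (Real.rpow_nonneg (zero_le_one.trans (one_le_eigenvalue hn hν α)) _)]
    exact mul_le_mul_of_nonneg_left (eigenvalue_rpow_le hn hν k α)
      (Finset.prod_nonneg fun j _ => abs_nonneg _)
  · obtain ⟨j, hj⟩ : ∃ j, α j < β j := by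
      by_contra! hcon
      exact hβ (Fintype.mem_piFinset.2 fun j => Finset.mem_range_succ_iff.2 (hcon j))
    rw [rieszMatrix, Finset.prod_eq_zero (Finset.mem_univ j) (deltaMatrix_of_lt _ _ hj), mul_zero,
      Complex.ofReal_zero]

theorem norm_sum_eigenvalue_rpow_smul_le (hn : 1 ≤ n) {ν : Fin n → ℝ} (hν : ∀ j, -1 / 2 ≤ ν j)
    {s : ℝ} (hs : s ≤ 0) (F : Finset (Fin n → ℕ)) (a : (Fin n → ℕ) → ℂ) :
    ‖∑ α ∈ F, a α • ((eigenvalue ν α ^ s : ℝ) : ℂ) • laguerreL2 hν α‖ ^ 2 ≤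
      1 ^ 2 * ∑ α ∈ F, ‖a α‖ ^ 2 := by
  simp only [smul_smul]
  rw [norm_sum_smul_sq_of_orthonormal (orthonormal_laguerreL2 hν), one_pow, one_mul]
  refine Finset.sum_le_sum fun α _ => pow_le_pow_left₀ (norm_nonneg _) ?_ 2
  have h1 := one_le_eigenvalue hn hν α
  rw [norm_mul, Complex.norm_real,
    Real.norm_of_nonneg (Real.rpow_nonneg (zero_le_one.trans h1) _)]
  exact mul_le_of_le_one_right (norm_nonneg _) (Real.rpow_le_one_of_one_le_of_nonpos h1 hs)

theorem IsTest.memLp {ψ : (Fin n → ℝ) → ℝ} (hψ : IsTest ψ) :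
    MemLp (fun x => (ψ x : ℂ)) 2 ((volume : Measure (Fin n → ℝ)).restrict (orthant n)) :=
  MemLp.restrict _ (MemLp.ofReal
    (hψ.contDiff.continuous.memLp_of_hasCompactSupport hψ.hasCompactSupport))

/-- Pairing with a test function is an inner product in `L²`. -/
theorem IsTest.inner_toLp {ψ : (Fin n → ℝ) → ℝ} (hψ : IsTest ψ) (f : L2 n) :
    inner ℂ (hψ.memLp.toLp _) f = ∫ x in orthant n, f x * (ψ x : ℂ) := by
  rw [L2.inner_def]
  refine integral_congr_ae ?_
  filter_upwards [hψ.memLp.coeFn_toLp] with x hx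
  rw [hx, RCLike.inner_apply, Complex.conj_ofReal]

theorem IsTest.inner_toLp_laguerreL2 {ψ : (Fin n → ℝ) → ℝ} (hψ : IsTest ψ) {ν : Fin n → ℝ}
    (hν : ∀ j, -1 / 2 ≤ ν j) (α : Fin n → ℕ) :
    inner ℂ (hψ.memLp.toLp _) (laguerreL2 hν α) =
      ((∫ x in orthant n, laguerreFun ν α x * ψ x : ℝ) : ℂ) := by
  rw [hψ.inner_toLp, ← integral_complex_ofReal]
  refine integral_congr_ae ?_
  filter_upwards [(memLp_laguerreFun hν α).coeFn_toLp] with x hx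
  rw [laguerreL2, hx, Complex.ofReal_mul]

theorem continuousOn_laguerreFun {ν : Fin n → ℝ} (hν : ∀ j, -1 / 2 ≤ ν j) (α : Fin n → ℕ) :
    ContinuousOn (laguerreFun ν α) (orthant n) :=
  continuousOn_prod_orthant fun j =>
    (isDelta_laguerreFun1_even (by linarith [hν j]) (α j)).continuousOn

/-- The weak identity on basis functions, paired with a test function. -/
theorem inner_deltaStarPow_laguerreL2 {ν : Fin n → ℝ} (hν : ∀ j, -1 / 2 ≤ ν j)
    (k α : Fin n → ℕ) {ψ : (Fin n → ℝ) → ℝ} (hψ : IsTest ψ) (hψ' : IsTest (deltaStarPow ν k ψ)) :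
    inner ℂ (hψ'.memLp.toLp _)
        (((eigenvalue ν α ^ (-((∑ j, (k j : ℝ)) / 2)) : ℝ) : ℂ) • laguerreL2 hν α) =
      inner ℂ (hψ.memLp.toLp _) (rieszImage hν k α) := by
  have h := integral_prod_mul_deltaStarPow (g := fun j p => deltaFun (ν j) (α j) p)
    (fun j p => isDelta_deltaFun (by linarith [hν j]) (α j) p) k hψ
  -- `δ^0 φ_α = φ_α` on the left, the expansion in shifted Laguerre functions on the right
  simp only [deltaFun_zero, prod_deltaFun_eq_sum, Finset.sum_mul, mul_assoc] at h
  rw [integral_finsetSum _ fun β _ => ((integrable_mul_of_continuousOn_orthant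
    (continuousOn_laguerreFun (neg_half_le_shiftedOrder hν k) β) hψ.contDiff.continuous
    hψ.hasCompactSupport hψ.tsupport_subset).restrict).const_mul _] at h
  simp only [integral_const_mul] at h
  rw [inner_smul_right, hψ'.inner_toLp_laguerreL2, rieszImage, inner_sum]
  simp only [inner_smul_right, hψ.inner_toLp_laguerreL2, rieszMatrix]
  rw [show (∫ x in orthant n, laguerreFun ν α x * deltaStarPow ν k ψ x) = _ from h]
  push_cast
  rw [Finset.mul_sum]
  exact Finset.sum_congr rfl fun β _ => by ring

end

end Laguerre

end

theorem proposition5p3 (n : ℕ) (hn : 1 ≤ n) (ν : Fin n → ℝ) (hν : ∀ j, -1 / 2 ≤ ν j)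
    (k : Fin n → ℕ) :
    ∃ T : Laguerre.L2 n →L[ℂ] Laguerre.L2 n,
      ∀ f : Laguerre.L2 n, Laguerre.IsRieszTransform hν k f (T f) := by
  have hφ := Laguerre.orthonormal_laguerreL2 hν
  have hs : -((∑ j, (k j : ℝ)) / 2) ≤ 0 := by
    have : 0 ≤ ∑ j, (k j : ℝ) := Finset.sum_nonneg fun j _ => Nat.cast_nonneg _
    linarith
  obtain ⟨C, hC, hT⟩ := Laguerre.exists_norm_sum_rieszImage_le hn hν k
  obtain ⟨T, hT⟩ := Laguerre.exists_clm_hasSum hφ hC hT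
  obtain ⟨S, hS⟩ := Laguerre.exists_clm_hasSum hφ zero_le_one
    (Laguerre.norm_sum_eigenvalue_rpow_smul_le hn hν hs)
  refine ⟨T, fun f => ⟨S f, ?_, fun ψ h1 h2 h3 => ?_⟩⟩
  · have h := hS f
    simp only [smul_comm (inner ℂ _ f)] at h
    exact h
  · have hψ : Laguerre.IsTest ψ := ⟨h1, h2, h3⟩
    have hψ' : Laguerre.IsTest (Laguerre.deltaStarPow ν k ψ) :=
      hψ.foldr_deltaStar ν k (List.finRange n)
    rw [← hψ'.inner_toLp, ← hψ.inner_toLp]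
    have h : ∀ α, innerSL ℂ (hψ'.memLp.toLp _) (inner ℂ (Laguerre.laguerreL2 hν α) f •
        ((Laguerre.eigenvalue ν α ^ (-((∑ j, (k j : ℝ)) / 2)) : ℝ) : ℂ) •
          Laguerre.laguerreL2 hν α) = innerSL ℂ (hψ.memLp.toLp _)
        (inner ℂ (Laguerre.laguerreL2 hν α) f • Laguerre.rieszImage hν k α) := fun α => by
      rw [innerSL_apply_apply, innerSL_apply_apply, inner_smul_right,
        Laguerre.inner_deltaStarPow_laguerreL2 hν k α hψ hψ', inner_smul_right]
    have hg := (hS f).mapL (innerSL ℂ (hψ'.memLp.toLp _))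
    rw [funext h] at hg
    exact hg.unique ((hT f).mapL (innerSL ℂ (hψ.memLp.toLp _)))
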